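/- **Setting.** Let $\mathcal G_d=(\mathcal V,\mathcal E)$ be a connected graph without loops or multiple edges, with a finite or countable vertex set, such that $1\le\deg(v)<\infty$ for every $v\in\mathcal V$, where $\deg(v)=\#\mathcal E_v$ and $\mathcal E_v$ is the set of edges incident to $v$. Let every edge $e$ have an initial vertex $e_o$, a terminal vertex $e_i$ and a length $|e|\in(0,\infty)$, with $\sup_{e}|e|<\infty$. Identify $e$ with the interval $(0,|e|)$, where $0$ corresponds to $e_o$ and $|e|$ to $e_i$, and put $L^2(\mathcal G)=\bigoplus_{e}L^2(0,|e|)$. Let $\mathbf H_{\max}$ be the operator $f\mapsto(-f_e'')_{e}$ in $L^2(\mathcal G)$ whose domain consists of all $f\in L^2(\mathcal G)$ with $f_e\in W^{2,2}(0,|e|)$ for all $e$ and $\sum_e\|f_e''\|^2<\infty$. For $f\in\operatorname{dom}(\mathbf H_{\max})$ and an endpoint $v$ of $e$ let $f_e(v)=\lim_{x\to v}f_e(x)$ and let $f_e'(v)=\lim_{x\to v}\frac{f_e(x)-f_e(v)}{|x-v|}$ be the derivative directed into the edge. Let $\alpha:\mathcal V\to\mathbb R$. Let $\mathbf H_\alpha^0$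 be the restriction of $\mathbf H_{\max}$ to those $f\in\operatorname{dom}(\mathbf H_{\max})$ that vanish on all but finitely many edges and satisfy, at every $v\in\mathcal V$: the values $f_e(v)$, $e\in\mathcal E_v$, are equal to a common value $f(v)$, and $\sum_{e\in\mathcal E_v}f_e'(v)=\alpha(v)f(v)$. *Boundary maps.* Let $\mathcal H_{\mathcal G}=\bigoplus_{v}\mathbb C^{\deg(v)}$ (Hilbert sum), with coordinates indexed by the pairs $(v,e)$, $e\in\mathcal E_v$. For $f\in\operatorname{dom}(\mathbf H_{\max})$ put $$(\widetilde\Gamma_0f)_{v,e}=|e|^{1/2}f_e(v),\qquad(\widetilde\Gamma_1f)_{v,e}=|e|^{-1/2}f_e'(v)+|e|^{-3/2}\big(f_e(v)-f_e(u)\big),$$ where $u$ is the endpoint of $e$ different from $v$. *The relation.* Enumerate each $\mathcal E_v$ in an arbitrary way. With $d=\deg(v)$, let $C_{v,\alpha}$ be the $d\times d$ matrix whose first $d-1$ rows are $(1,-1,0,\dots,0),(0,1,-1,0,\dots,0),\dots,(0,\dots,0,1,-1)$ and whose last row is $(\alpha(v),0,\dots,0)$, and let $D_v$ be the $d\times d$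 matrix with last row $(1,\dots,1)$ and all other rows zero. Put $C_\alpha^0=\bigoplus_vC_{v,\alpha}$, $D^0=\bigoplus_vD_v$, $(\widetilde Rf)_{v,e}=|e|^{1/2}f_{v,e}$, $(\widetilde Qf)_{v,e}=|e|^{-1}(-f_{v,e}+f_{u,e})$ with $u$ as above, and $$C_\alpha=(C_\alpha^0-D^0\widetilde Q)\widetilde R^{-1},\qquad D=D^0\widetilde R .$$ Let $\Theta_\alpha^0$ be the set of all pairs $\{f,g\}$ of vectors of $\mathcal H_{\mathcal G}$ with finitely many nonzero coordinates such that $C_\alpha f=Dg$, and let $\Theta_\alpha$ be its closure in $\mathcal H_{\mathcal G}\times\mathcal H_{\mathcal G}$. The operator part $\Theta_\alpha^{\rm op}$ of $\Theta_\alpha$ is the orthogonal complement in $\Theta_\alpha$ of $\{0\}\times\operatorname{mul}\Theta_\alpha$, where $\operatorname{mul}\Theta_\alpha=\{g:\{0,g\}\in\Theta_\alpha\}$; put $\mathcal H_{\rm op}=\overline{\operatorname{dom}(\Theta_\alpha)}$. *The discrete Laplacian.* Let $m(v)=\sum_{e\in\mathcal E_v}|e|$, let $b(v,u)=|e_{v,u}|^{-1}$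 if $v$ and $u$ are joined by an edge $e_{v,u}$ and $b(v,u)=0$ otherwise, and let $\mathrm h_\alpha^0$ be the operator in $\ell^2(\mathcal V)$, defined on the finitely supported functions, given by $$(\mathrm h_\alpha^0f)(v)=\frac1{\sqrt{m(v)}}\Big(\sum_{u\in\mathcal V}b(v,u)\Big(\frac{f(v)}{\sqrt{m(v)}}-\frac{f(u)}{\sqrt{m(u)}}\Big)+\frac{\alpha(v)}{\sqrt{m(v)}}f(v)\Big).$$ **Proposition 3.4.** The maps $\widetilde\Gamma_0,\widetilde\Gamma_1:\operatorname{dom}(\mathbf H_{\max})\to\mathcal H_{\mathcal G}$ are well defined, and $\mathbf H_\alpha^0$ and $\mathrm h_\alpha^0$ are closable. Let $\mathbf H_\alpha$ and $\mathrm h_\alpha$ be their closures. Then $$\operatorname{dom}(\mathbf H_\alpha)=\{f\in\operatorname{dom}(\mathbf H_{\max}):\{\widetilde\Gamma_0f,\widetilde\Gamma_1f\}\in\Theta_\alpha\}.$$ Moreover, the operator part $\Theta_\alpha^{\rm op}$, acting in $\mathcal H_{\rm op}$, is unitarily equivalent to the operator $\mathrm h_\alpha$ acting in $\ell^2(\mathcal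 V)$. -/

import Mathlib

open MeasureTheory Set Filter Topology
open scoped ENNReal ContDiff

noncomputable section

namespace QuantumGraph

/-! ### Weak derivatives on a bounded interval -/

/-- The complex Hilbert space `L²(0, ℓ)`. -/
abbrev L2Interval (ℓ : ℝ) : Type := Lp ℂ 2 (volume.restrict (Ioo (0 : ℝ) ℓ))

/-- `g` is the weak derivative of `f` on `(0, ℓ)`: `∫ φ' f = - ∫ φ g` for all test functions
`φ ∈ C_c^∞(0, ℓ)`. -/
def HasWeakDeriv {ℓ : ℝ} (f g : L2Interval ℓ) : Prop :=
  ∀ φ : ℝ → ℝ, ContDiff ℝ ∞ φ → HasCompactSupport φ → tsupport φ ⊆ Ioo 0 ℓ →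
    ∫ x in Ioo 0 ℓ, deriv φ x • f x = - ∫ x in Ioo 0 ℓ, φ x • g x

/-- `f` belongs to the Sobolev space `W^{2,2}(0, ℓ)` and its second weak derivative is `h`. -/
def HasSecondDeriv {ℓ : ℝ} (f h : L2Interval ℓ) : Prop :=
  ∃ g : L2Interval ℓ, HasWeakDeriv f g ∧ HasWeakDeriv g h

theorem integrable_smul_L2 {ℓ : ℝ} {φ : ℝ → ℝ} (hφ : Continuous φ) (hc : HasCompactSupport φ)
    (f : L2Interval ℓ) : IntegrableOn (fun x => φ x • f x) (Ioo 0 ℓ) := by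
  have hf : Integrable (f : ℝ → ℂ) (volume.restrict (Ioo (0 : ℝ) ℓ)) :=
    (Lp.memLp f).integrable (by norm_num)
  obtain ⟨C, hC⟩ := hc.exists_bound_of_continuous hφ
  exact hf.bdd_smul C hφ.aestronglyMeasurable (ae_of_all _ hC)

theorem integral_smul_add {ℓ : ℝ} {φ : ℝ → ℝ} (hφ : Continuous φ) (hc : HasCompactSupport φ)
    (f f' : L2Interval ℓ) : ∫ x in Ioo 0 ℓ, φ x • (f + f' : L2Interval ℓ) x =
      (∫ x in Ioo 0 ℓ, φ x • f x) + ∫ x in Ioo 0 ℓ, φ x • f' x := by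
  rw [← integral_add (integrable_smul_L2 hφ hc f) (integrable_smul_L2 hφ hc f')]
  apply integral_congr_ae
  filter_upwards [Lp.coeFn_add f f'] with x hx
  rw [hx, Pi.add_apply, smul_add]

theorem integral_smul_smul {ℓ : ℝ} (φ : ℝ → ℝ) (c : ℂ) (f : L2Interval ℓ) :
    ∫ x in Ioo 0 ℓ, φ x • (c • f : L2Interval ℓ) x = c * ∫ x in Ioo 0 ℓ, φ x • f x := by
  rw [← integral_const_mul]
  apply integral_congr_ae
  filter_upwards [Lp.coeFn_smul c f] with x hx
  rw [hx, Pi.smul_apply, smul_comm, smul_eq_mul]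

theorem integral_smul_zero {ℓ : ℝ} (φ : ℝ → ℝ) :
    ∫ x in Ioo 0 ℓ, φ x • (0 : L2Interval ℓ) x = 0 := by
  rw [← integral_zero ℝ ℂ]
  apply integral_congr_ae
  filter_upwards [Lp.coeFn_zero ℂ 2 (volume.restrict (Ioo (0 : ℝ) ℓ))] with x hx
  rw [hx]; simp

theorem HasWeakDeriv.zero {ℓ : ℝ} : HasWeakDeriv (0 : L2Interval ℓ) 0 := by
  intro φ _ _ _
  rw [integral_smul_zero, integral_smul_zero, neg_zero]

theorem HasWeakDeriv.add {ℓ : ℝ} {f g f' g' : L2Interval ℓ} (h : HasWeakDeriv f g)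
    (h' : HasWeakDeriv f' g') : HasWeakDeriv (f + f') (g + g') := by
  intro φ hφ hc hs
  rw [integral_smul_add (hφ.continuous_deriv (by simp)) hc.deriv,
    integral_smul_add hφ.continuous hc, h φ hφ hc hs, h' φ hφ hc hs]
  ring

theorem HasWeakDeriv.smul {ℓ : ℝ} {f g : L2Interval ℓ} (c : ℂ) (h : HasWeakDeriv f g) :
    HasWeakDeriv (c • f) (c • g) := by
  intro φ hφ hc hs
  rw [integral_smul_smul, integral_smul_smul, h φ hφ hc hs]
  ring

theorem HasWeakDeriv.eq_zero {ℓ : ℝ} {g : L2Interval ℓ} (h : HasWeakDeriv 0 g) : g = 0 := by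
  have hg : Integrable (g : ℝ → ℂ) (volume.restrict (Ioo (0 : ℝ) ℓ)) :=
    (Lp.memLp g).integrable (by norm_num)
  have key := isOpen_Ioo.ae_eq_zero_of_integral_contDiff_smul_eq_zero
    (μ := volume.restrict (Ioo (0 : ℝ) ℓ)) (f := (g : ℝ → ℂ)) (U := Ioo 0 ℓ)
    (hg.locallyIntegrable.locallyIntegrableOn _) (by
      intro φ hφ hc hs
      have h1 := h φ hφ hc hs
      rw [integral_smul_zero] at h1
      exact neg_eq_zero.mp h1.symm)
  apply Lp.ext
  filter_upwards [key, ae_restrict_mem measurableSet_Ioo,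
    Lp.coeFn_zero ℂ 2 (volume.restrict (Ioo (0 : ℝ) ℓ))] with x h1 h2 h3
  rw [h1 h2, h3]; rfl

/-! ### Metric graphs -/

/-- A metric graph over the simple combinatorial graph `G`: every edge `e` has an initial vertex
`src e`, a terminal vertex `tgt e` and a length in `(0, ∞)`. The edge is identified with the
interval `(0, len e)`, where `src e` corresponds to `0` and `tgt e` to `len e`. -/
structure MetricGraph {V : Type*} (G : SimpleGraph V) where
  src : G.edgeSet → V
  tgt : G.edgeSet → V
  src_tgt : ∀ e : G.edgeSet, s(src e, tgt e) = (e : Sym2 V)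
  len : G.edgeSet → ℝ
  len_pos : ∀ e, 0 < len e

/-- The set of edges incident to the vertex `v`. -/
abbrev Inc {V : Type*} (G : SimpleGraph V) (v : V) : Type _ :=
  {e : G.edgeSet // v ∈ (e : Sym2 V)}

/-- The degree of `v`, the number of edges incident to `v`. -/
def deg {V : Type*} (G : SimpleGraph V) [∀ v, Fintype (Inc G v)] (v : V) : ℕ :=
  Fintype.card (Inc G v)

/-- The endpoint different from `v` of an edge incident to `v`. -/
def opp {V : Type*} {G : SimpleGraph V} {v : V} (e : Inc G v) : V := Sym2.Mem.other e.2

/-- The same edge, seen from the endpoint different from `v`. -/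
def oppInc {V : Type*} {G : SimpleGraph V} {v : V} (e : Inc G v) : Inc G (opp e) :=
  ⟨e.1, Sym2.other_mem e.2⟩

namespace MetricGraph

variable {V : Type*} {G : SimpleGraph V} (M : MetricGraph G)

/-- The Hilbert space `L²` of the metric graph, the Hilbert sum of the spaces `L²(0, |e|)`. -/
abbrev L2 : Type _ := lp (fun e : G.edgeSet => L2Interval (M.len e)) 2

/-! ### The maximal operator -/

/-- The graph of the maximal operator: the pairs `(f, h)` in `L²` such that on every edge
`f_e ∈ W^{2,2}(0, |e|)` and `h_e = - f_e''`. -/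
def maxGraph : Submodule ℂ (M.L2 × M.L2) where
  carrier := {p | ∀ e, HasSecondDeriv (p.1 e) (-(p.2 e))}
  zero_mem' := by
    intro e
    refine ⟨0, HasWeakDeriv.zero, ?_⟩
    have h : -((0 : M.L2 × M.L2).2 e) = 0 := neg_zero
    rw [h]
    exact HasWeakDeriv.zero
  add_mem' := by
    intro p q hp hq e
    obtain ⟨g, h1, h2⟩ := hp e
    obtain ⟨g', h1', h2'⟩ := hq e
    refine ⟨g + g', h1.add h1', ?_⟩
    have := h2.add h2'
    rwa [← neg_add] at this
  smul_mem' := by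
    intro c p hp e
    obtain ⟨g, h1, h2⟩ := hp e
    refine ⟨c • g, h1.smul c, ?_⟩
    have := h2.smul c
    rwa [smul_neg] at this

/-- The maximal operator `H_max`, acting as `- d²/dx²` on every edge: its domain consists of the
`f` in `L²` with `f_e ∈ W^{2,2}(0, |e|)` for every `e` and `∑_e ‖f_e''‖² < ∞`. -/
def Hmax : M.L2 →ₗ.[ℂ] M.L2 := M.maxGraph.toLinearPMap

theorem maxGraph_single_valued (p : M.L2 × M.L2) (hp : p ∈ M.maxGraph) (h : p.1 = 0) :
    p.2 = 0 := by
  apply lp.ext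
  funext e
  obtain ⟨g, h1, h2⟩ := hp e
  have h0 : p.1 e = 0 := by rw [h]; rfl
  rw [h0] at h1
  rw [h1.eq_zero] at h2
  exact neg_eq_zero.mp h2.eq_zero

theorem Hmax_graph : M.Hmax.graph = M.maxGraph :=
  Submodule.toLinearPMap_graph_eq _ M.maxGraph_single_valued

/-! ### Boundary values -/

/-- For an edge `e` incident to `v`, the function `f` has at `v` the boundary value `f_e(v) = c`
and the inward derivative `f_e'(v) = d`. Both are limits, from inside the edge, of the continuous
representative `F` of `f_e`: `c = lim F(x)` and `d = lim (F(x) - c) / |x - v|` as `x → v`. -/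
def HasVertexData (f : M.L2) (v : V) (e : Inc G v) (c d : ℂ) : Prop :=
  ∃ F : ℝ → ℂ, ContinuousOn F (Ioo 0 (M.len e.1)) ∧
    F =ᵐ[volume.restrict (Ioo 0 (M.len e.1))] f e.1 ∧
    (v = M.src e.1 → Tendsto F (𝓝[>] 0) (𝓝 c) ∧
      Tendsto (fun x : ℝ => (F x - c) / (x : ℂ)) (𝓝[>] 0) (𝓝 d)) ∧
    (v = M.tgt e.1 → Tendsto F (𝓝[<] M.len e.1) (𝓝 c) ∧
      Tendsto (fun x : ℝ => (F x - c) / ((M.len e.1 - x : ℝ) : ℂ)) (𝓝[<] M.len e.1) (𝓝 d))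

theorem HasVertexData.add {M : MetricGraph G} {f f' : M.L2} {v : V} {e : Inc G v} {c d c' d' : ℂ}
    (h : M.HasVertexData f v e c d) (h' : M.HasVertexData f' v e c' d') :
    M.HasVertexData (f + f') v e (c + c') (d + d') := by
  obtain ⟨F, hF, hae, h0, h1⟩ := h
  obtain ⟨F', hF', hae', h0', h1'⟩ := h'
  refine ⟨F + F', hF.add hF', ?_, ?_, ?_⟩
  · exact (hae.add hae').trans (Lp.coeFn_add (f e.1) (f' e.1)).symm
  · intro hv
    refine ⟨(h0 hv).1.add (h0' hv).1, ((h0 hv).2.add (h0' hv).2).congr fun x => ?_⟩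
    simp only [Pi.add_apply]; ring
  · intro hv
    refine ⟨(h1 hv).1.add (h1' hv).1, ((h1 hv).2.add (h1' hv).2).congr fun x => ?_⟩
    simp only [Pi.add_apply]; ring

theorem HasVertexData.smul {M : MetricGraph G} {f : M.L2} {v : V} {e : Inc G v} {c d : ℂ} (t : ℂ)
    (h : M.HasVertexData f v e c d) : M.HasVertexData (t • f) v e (t * c) (t * d) := by
  obtain ⟨F, hF, hae, h0, h1⟩ := h
  refine ⟨t • F, hF.const_smul t, ?_, ?_, ?_⟩
  · exact (hae.const_smul t).trans (Lp.coeFn_smul t (f e.1)).symm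
  · intro hv
    refine ⟨(h0 hv).1.const_mul t, ((h0 hv).2.const_mul t).congr fun x => ?_⟩
    simp only [Pi.smul_apply, smul_eq_mul]; ring
  · intro hv
    refine ⟨(h1 hv).1.const_mul t, ((h1 hv).2.const_mul t).congr fun x => ?_⟩
    simp only [Pi.smul_apply, smul_eq_mul]; ring

theorem HasVertexData.zero (v : V) (e : Inc G v) : M.HasVertexData 0 v e 0 0 := by
  refine ⟨0, continuousOn_const, (Lp.coeFn_zero _ _ _).symm, ?_, ?_⟩ <;>
  · intro _
    exact ⟨tendsto_const_nhds, tendsto_const_nhds.congr fun x => by simp⟩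

/-! ### Diagonal operators and the edge weight -/

/-- The diagonal operator `R̃`, multiplying the coordinate `(v, e)` by `|e|^{1/2}`. -/
def Rmap : (∀ v, Inc G v → ℂ) →ₗ[ℂ] (∀ v, Inc G v → ℂ) where
  toFun f := fun v e => ((√(M.len e.1) : ℝ) : ℂ) * f v e
  map_add' f g := by funext v e; simp [mul_add]
  map_smul' t f := by funext v e; simp [mul_left_comm]

/-- The inverse of `R̃`. -/
def RinvMap : (∀ v, Inc G v → ℂ) →ₗ[ℂ] (∀ v, Inc G v → ℂ) where
  toFun f := fun v e => ((√(M.len e.1) : ℝ) : ℂ)⁻¹ * f v e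
  map_add' f g := by funext v e; simp [mul_add]
  map_smul' t f := by funext v e; simp [mul_left_comm]

/-- The operator `Q̃`: `(Q̃ f)_{v,e} = |e|⁻¹ (- f_{v,e} + f_{u,e})`, where `u` is the endpoint
of `e` different from `v`. -/
def Qmap : (∀ v, Inc G v → ℂ) →ₗ[ℂ] (∀ v, Inc G v → ℂ) where
  toFun f := fun v e => ((M.len e.1 : ℝ) : ℂ)⁻¹ * (-f v e + f (opp e) (oppInc e))
  map_add' f g := by funext v e; simp only [Pi.add_apply]; ring
  map_smul' t f := by
    funext v e; simp only [Pi.smul_apply, smul_eq_mul, RingHom.id_apply]; ring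

open Classical in
/-- The edge weight `b(v, u)`, equal to `1 / |e|` if `e` is the edge joining `v` and `u`, and to
`0` if `v` and `u` are not adjacent. -/
def edgeWeight (v u : V) : ℝ :=
  if h : G.Adj v u then (M.len ⟨s(v, u), h⟩)⁻¹ else 0

theorem edgeWeight_of_not_adj {v u : V} (h : ¬ G.Adj v u) : M.edgeWeight v u = 0 := by
  simp [edgeWeight, h]

/-! ### The operator with delta couplings -/

variable [∀ v, Fintype (Inc G v)]

/-- The delta-type condition of strength `a` at `v`: all the boundary values `f_e(v)` are equal
to a common value `f(v) = c`, and `∑_e f_e'(v) = a f(v)`. -/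
def DeltaCondition (a : ℝ) (f : M.L2) (v : V) : Prop :=
  ∃ (c : ℂ) (d : Inc G v → ℂ), (∀ e, M.HasVertexData f v e c (d e)) ∧ ∑ e, d e = (a : ℂ) * c

/-- The functions that vanish on all but finitely many edges and satisfy the delta-type condition
of strength `α v` at every vertex `v`. -/
def deltaDomain (α : V → ℝ) : Submodule ℂ M.L2 where
  carrier := {f | {e | f e ≠ 0}.Finite ∧ ∀ v, M.DeltaCondition (α v) f v}
  zero_mem' := ⟨by simp, fun v => ⟨0, 0, fun e => HasVertexData.zero M v e, by simp⟩⟩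
  add_mem' := by
    rintro f g ⟨hf, hf'⟩ ⟨hg, hg'⟩
    refine ⟨(hf.union hg).subset fun e he => ?_, fun v => ?_⟩
    · by_contra hne
      simp only [mem_union, mem_ofPred_eq, not_or, not_not] at hne
      exact he (by rw [lp.coeFn_add, Pi.add_apply, hne.1, hne.2, add_zero])
    · obtain ⟨c, d, h1, h2⟩ := hf' v
      obtain ⟨c', d', h1', h2'⟩ := hg' v
      refine ⟨c + c', d + d', fun e => (h1 e).add (h1' e), ?_⟩
      simp only [Pi.add_apply, Finset.sum_add_distrib, h2, h2', mul_add]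
  smul_mem' := by
    rintro t f ⟨hf, hf'⟩
    refine ⟨hf.subset fun e he => ?_, fun v => ?_⟩
    · intro h0
      exact he (by rw [lp.coeFn_smul, Pi.smul_apply, h0, smul_zero])
    · obtain ⟨c, d, h1, h2⟩ := hf' v
      refine ⟨t * c, fun e => t * d e, fun e => (h1 e).smul t, ?_⟩
      rw [← Finset.mul_sum, h2]; ring

/-- The pre-minimal operator `H_α⁰`: the restriction of `H_max` to the functions in its domain
that vanish on all but finitely many edges and satisfy the delta-type conditions. -/
def Halpha0 (α : V → ℝ) : M.L2 →ₗ.[ℂ] M.L2 := M.Hmax.domRestrict (M.deltaDomain α)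

/-- The operator `H_α`, the closure of `H_α⁰`. -/
def Halpha (α : V → ℝ) : M.L2 →ₗ.[ℂ] M.L2 := (M.Halpha0 α).closure

/-! ### The boundary space and the boundary maps -/

variable (G) in
/-- The boundary space `⊕_v ℂ^{deg v}`, with the coordinates of the `v`-th summand indexed by the
edges incident to `v`. -/
abbrev BdrySpace : Type _ := lp (fun v : V => EuclideanSpace ℂ (Inc G v)) 2

/-- `x` and `y` are the boundary values `Γ̃₀ f` and `Γ̃₁ f` of `f`, that is, for `e` incident
to `v`, with opposite endpoint `u`,
`x_{v,e} = |e|^{1/2} f_e(v)` and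
`y_{v,e} = |e|^{-1/2} f_e'(v) + |e|^{-3/2} (f_e(v) - f_e(u))`. -/
def IsBoundaryData (f : M.L2) (x y : BdrySpace G) : Prop :=
  ∃ a b : (v : V) → Inc G v → ℂ, (∀ v e, M.HasVertexData f v e (a v e) (b v e)) ∧
    ∀ v e, x v e = ((√(M.len e.1) : ℝ) : ℂ) * a v e ∧
      y v e = ((√(M.len e.1) : ℝ) : ℂ)⁻¹ * b v e +
        ((M.len e.1 * √(M.len e.1) : ℝ) : ℂ)⁻¹ * (a v e - a (opp e) (oppInc e))

/-! ### The relation parameterizing the delta couplings -/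

/-- The `d × d` matrix with rows `(1, -1, 0, …)`, `(0, 1, -1, 0, …)`, …, `(0, …, 0, 1, -1)`
and last row `(a, 0, …, 0)`. -/
def Cmat (d : ℕ) (a : ℝ) : Matrix (Fin d) (Fin d) ℂ := fun i j =>
  if (i : ℕ) + 1 < d then
    (if (j : ℕ) = i then 1 else if (j : ℕ) = i + 1 then -1 else 0)
  else (if (j : ℕ) = 0 then (a : ℂ) else 0)

/-- The `d × d` matrix with last row `(1, …, 1)` and all other rows zero. -/
def Dmat (d : ℕ) : Matrix (Fin d) (Fin d) ℂ := fun i _ => if (i : ℕ) + 1 = d then 1 else 0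

/-- The block-diagonal operator with blocks `A v`; the edges at `v` are enumerated by `enum v`. -/
def blockDiag (enum : ∀ v, Fin (deg G v) ≃ Inc G v)
    (A : ∀ v, Matrix (Fin (deg G v)) (Fin (deg G v)) ℂ) :
    (∀ v, Inc G v → ℂ) →ₗ[ℂ] (∀ v, Fin (deg G v) → ℂ) where
  toFun f := fun v => (A v).mulVec (f v ∘ enum v)
  map_add' f g := by
    funext v
    exact Matrix.mulVec_add (A v) (f v ∘ enum v) (g v ∘ enum v)
  map_smul' t f := by
    funext v
    exact Matrix.mulVec_smul (A v) t (f v ∘ enum v)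

/-- `C_α = (C_α⁰ - D⁰ Q̃) R̃⁻¹`, where `C_α⁰` and `D⁰` are the block-diagonal operators with
blocks `Cmat (deg v) (α v)` and `Dmat (deg v)`. -/
def Calpha (enum : ∀ v, Fin (deg G v) ≃ Inc G v) (α : V → ℝ) :
    (∀ v, Inc G v → ℂ) →ₗ[ℂ] (∀ v, Fin (deg G v) → ℂ) :=
  (blockDiag enum (fun v => Cmat (deg G v) (α v)) -
    blockDiag enum (fun v => Dmat (deg G v)) ∘ₗ M.Qmap) ∘ₗ M.RinvMap

/-- `D = D⁰ R̃`. -/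
def Dmap (enum : ∀ v, Fin (deg G v) ≃ Inc G v) :
    (∀ v, Inc G v → ℂ) →ₗ[ℂ] (∀ v, Fin (deg G v) → ℂ) :=
  blockDiag enum (fun v => Dmat (deg G v)) ∘ₗ M.Rmap

variable (G) in
/-- The coordinates of a vector of the boundary space. -/
def coords : BdrySpace G →ₗ[ℂ] (∀ v, Inc G v → ℂ) where
  toFun x := fun v e => x v e
  map_add' _ _ := rfl
  map_smul' _ _ := rfl

variable (G) in
/-- The vectors of the boundary space with only finitely many nonzero coordinates. -/
def finiteVectors : Submodule ℂ (BdrySpace G) where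
  carrier := {x | {p : Σ v, Inc G v | x p.1 p.2 ≠ 0}.Finite}
  zero_mem' := by
    have : {p : Σ v, Inc G v | (0 : BdrySpace G) p.1 p.2 ≠ 0} = ∅ := by
      ext p; simp
    simp only [mem_ofPred_eq]
    rw [this]
    exact finite_empty
  add_mem' := by
    intro x y hx hy
    refine (hx.union hy).subset fun p hp => ?_
    by_contra hne
    simp only [mem_union, mem_ofPred_eq, not_or, not_not] at hne
    exact hp (by simp [hne.1, hne.2])
  smul_mem' := by
    intro t x hx
    refine hx.subset fun p hp => ?_
    intro h0
    exact hp (by simp [h0])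

/-- The linear relation `Θ_α⁰ = {(f, g) | C_α f = D g}` on vectors with finitely many nonzero
coordinates. -/
def Theta0 (enum : ∀ v, Fin (deg G v) ≃ Inc G v) (α : V → ℝ) :
    Submodule ℂ (BdrySpace G × BdrySpace G) :=
  (finiteVectors G).prod (finiteVectors G) ⊓
    LinearMap.eqLocus (M.Calpha enum α ∘ₗ coords G ∘ₗ LinearMap.fst ℂ _ _)
      (M.Dmap enum ∘ₗ coords G ∘ₗ LinearMap.snd ℂ _ _)

/-- The linear relation `Θ_α`, the closure of `Θ_α⁰`. -/
def Theta (enum : ∀ v, Fin (deg G v) ≃ Inc G v) (α : V → ℝ) :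
    Submodule ℂ (BdrySpace G × BdrySpace G) :=
  (M.Theta0 enum α).topologicalClosure

/-! ### The discrete Laplacian -/

/-- The vertex weight `m(v)`, the sum of the lengths of the edges incident to `v`. -/
def weight (v : V) : ℝ := ∑ e : Inc G v, M.len e.1

/-- The difference expression
`(τ f)(v) = m(v)^{-1/2} (∑_u b(v,u) (f(v) m(v)^{-1/2} - f(u) m(u)^{-1/2}) + α(v) m(v)^{-1/2} f(v))`.
The sum has only finitely many nonzero terms. -/
def tau (α : V → ℝ) (f : V → ℂ) (v : V) : ℂ :=
  ((√(M.weight v) : ℝ) : ℂ)⁻¹ *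
    ((∑ᶠ u, (M.edgeWeight v u : ℂ) *
        (f v / ((√(M.weight v) : ℝ) : ℂ) - f u / ((√(M.weight u) : ℝ) : ℂ))) +
      (α v : ℂ) / ((√(M.weight v) : ℝ) : ℂ) * f v)

variable (G) in
theorem finite_neighbors (v : V) : {u | G.Adj v u}.Finite := by
  have : Set.InjOn (fun u => s(v, u)) {u | G.Adj v u} := by
    intro u _ w _ h
    exact Sym2.congr_right.mp h
  refine Set.Finite.of_finite_image ?_ this
  refine (Set.finite_range (fun e : Inc G v => (e.1 : Sym2 V))).subset ?_
  rintro _ ⟨u, hu, rfl⟩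
  exact ⟨⟨⟨s(v, u), hu⟩, Sym2.mem_mk_left v u⟩, rfl⟩

theorem finite_support_term (v : V) (g : V → ℂ) :
    (Function.support fun u => (M.edgeWeight v u : ℂ) * g u).Finite := by
  refine (finite_neighbors G v).subset fun u hu => ?_
  by_contra h
  exact hu (by simp [M.edgeWeight_of_not_adj h])

theorem tau_add (α : V → ℝ) (f g : V → ℂ) : M.tau α (f + g) = M.tau α f + M.tau α g := by
  funext v
  simp only [tau, Pi.add_apply]
  rw [← mul_add]
  congr 1
  rw [add_add_add_comm, ← finsum_add_distrib (M.finite_support_term v _)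
    (M.finite_support_term v _)]
  congr 1
  · exact finsum_congr fun u => by ring
  · ring

theorem tau_smul (α : V → ℝ) (t : ℂ) (f : V → ℂ) : M.tau α (t • f) = t • M.tau α f := by
  funext v
  simp only [tau, Pi.smul_apply, smul_eq_mul]
  rw [mul_left_comm t]
  congr 1
  rw [mul_add]
  rw [mul_finsum]
  congr 1
  · exact finsum_congr fun u => by ring
  · ring

theorem tau_finite_support (α : V → ℝ) {f : V → ℂ} (hf : {v | f v ≠ 0}.Finite) :
    {v | M.tau α f v ≠ 0}.Finite := by
  refine (hf.union (hf.biUnion fun v _ => finite_neighbors G v)).subset fun v hv => ?_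
  by_contra h
  simp only [mem_union, mem_ofPred_eq, mem_iUnion, not_or, not_not, not_exists] at h
  obtain ⟨h1, h2⟩ := h
  apply hv
  have h3 : ∀ u, (M.edgeWeight v u : ℂ) *
      (f v / ((√(M.weight v) : ℝ) : ℂ) - f u / ((√(M.weight u) : ℝ) : ℂ)) = 0 := by
    intro u
    by_cases hu : f u = 0
    · simp [h1, hu]
    · simp [M.edgeWeight_of_not_adj fun hadj => h2 u hu hadj.symm]
  rw [tau, finsum_congr h3, finsum_zero, h1, mul_zero, add_zero, mul_zero]

/-- The pre-minimal discrete Laplacian `h_α⁰` in `ℓ²(V)`: it acts as `τ` on the finitely supported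
functions. -/
def discreteLaplacian0 (α : V → ℝ) :
    lp (fun _ : V => ℂ) 2 →ₗ.[ℂ] lp (fun _ : V => ℂ) 2 where
  domain :=
    { carrier := {f | {v | f v ≠ 0}.Finite}
      zero_mem' := by simp
      add_mem' := by
        intro f g hf hg
        refine (hf.union hg).subset fun v hv => ?_
        by_contra hne
        simp only [mem_union, mem_ofPred_eq, not_or, not_not] at hne
        exact hv (by simp [hne.1, hne.2])
      smul_mem' := by
        intro t f hf
        refine hf.subset fun v hv => ?_
        intro h0
        exact hv (by simp [h0]) }
  toFun :=
    { toFun := fun f => ⟨M.tau α (f : lp (fun _ : V => ℂ) 2),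
        (memℓp_zero (M.tau_finite_support α f.2)).of_exponent_ge zero_le⟩
      map_add' := fun f g => by
        apply lp.ext
        exact M.tau_add α _ _
      map_smul' := fun t f => by
        apply lp.ext
        exact M.tau_smul α t _ }

/-- The discrete Laplacian `h_α`, the closure of `h_α⁰`. -/
def discreteLaplacian (α : V → ℝ) : lp (fun _ : V => ℂ) 2 →ₗ.[ℂ] lp (fun _ : V => ℂ) 2 :=
  (M.discreteLaplacian0 α).closure

end MetricGraph

/-! ### Linear relations -/

/-- The domain of a linear relation. -/
def relDomain {H : Type*} [NormedAddCommGroup H] [InnerProductSpace ℂ H]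
    (Θ : Submodule ℂ (H × H)) : Submodule ℂ H :=
  Θ.map (LinearMap.fst ℂ H H)

/-- The operator part of a linear relation `Θ`: the orthogonal complement in `Θ` of
`{0} × mul Θ`, where `mul Θ = {g | (0, g) ∈ Θ}`. -/
def operatorPart {H : Type*} [NormedAddCommGroup H] [InnerProductSpace ℂ H]
    (Θ : Submodule ℂ (H × H)) : Set (H × H) :=
  {p | p ∈ Θ ∧ ∀ g : H, (0, g) ∈ Θ → inner ℂ g p.2 = 0}

end QuantumGraph

end

noncomputable section

namespace QuantumGraph

/-! Write `w = (f, h)` with `h = -f''`. On an edge of length `ℓ`, let `t` be the normalised distance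
to the endpoint `v`. Green's formula with the kernels `t (1 - t)²` and `1 - t` expresses the
boundary data at `v` as integrals: the first coordinate is `√ℓ (ℓ⁻¹ ∫ (4 - 6t) f - ℓ ∫ t (1 - t)²
h)`, and the second is `ℓ^(-1/2) ∫ (1 - t) h`, which involves `h` alone. By Cauchy–Schwarz they are
bounded by `4‖f‖ + ℓ²‖h‖` and `‖h‖`, uniformly because the lengths are bounded. So both boundary
maps are restrictions of one bounded operator `bdryMap` on `L² × L²`. Cubic polynomials on the edges
give a bounded right inverse `liftMap` with values in the graph of `H_max`.

For the domain: `H_α⁰` consists of the `w` in the graph of `H_max` with finitely many nonzero edges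
and `bdryMap w ∈ Θ_α⁰` (`mem_graph_Halpha0_iff_bdryMap`). The graph of `H_max` is closed and
`bdryMap` is continuous, so the closure stays inside `bdryMap⁻¹ Θ_α`. Conversely, split `w` into
`liftMap (bdryMap w)` and a remainder with zero boundary data. The first part is a limit of lifts of
elements of `Θ_α⁰`. Zero boundary data is a condition on each edge separately, so the remainder is
the sum of its restrictions to single edges, each in `H_α⁰`. This is
`mem_closure_graph_Halpha0_iff`.

For the unitary equivalence: a pair in `Θ_α⁰` has first component `|e|^{1/2} c(v)`, that is `U f`
with `f = √m c`, where `U` is the isometry `f ↦ (f(v) ω_v)_v` and `ω_v` is the unit vector along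
`(|e|^{1/2})_e`. The remaining equation says `U* g = h_α⁰ f`. Since also `{0} × ker U* ⊆ Θ_α`, the
closure is `{(U f, g) | U* g = h_α f}`. Its multivalued part is `ker U* = (ran U)ᗮ`, so its operator
part is `{(U f, U h_α f)}`; `exists_equiv_operatorPart` carries this out for an abstract isometry.
-/

/-! ### Integration by parts and the du Bois-Reymond lemma -/

/-- Integration by parts for the primitive of an integrable function. -/
theorem integral_smul_eq_sub_of_primitive {ℓ : ℝ} (hℓ : 0 ≤ ℓ) {k k' : ℝ → ℝ}
    (hk : ∀ x, HasDerivAt k (k' x) x) (hk' : Continuous k') {h : ℝ → ℂ}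
    (hh : IntegrableOn h (Ioc 0 ℓ)) (B : ℂ) :
    ∫ x in Ioc 0 ℓ, k x • h x = k ℓ • (B + ∫ t in (0 : ℝ)..ℓ, h t) - k 0 • B -
      ∫ x in Ioc 0 ℓ, k' x • (B + ∫ t in (0 : ℝ)..x, h t) := by
  have hkc : Continuous k := continuous_iff_continuousAt.2 fun x => (hk x).continuousAt
  have hftc : ∀ a b, ∫ x in a..b, k' x = k b - k a := fun a b =>
    intervalIntegral.integral_eq_sub_of_hasDerivAt (fun x _ => hk x) (hk'.intervalIntegrable _ _)
  set μ := volume.restrict (Ioc (0 : ℝ) ℓ) with hμ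
  have hk'i : Integrable k' μ := hk'.integrableOn_Ioc
  have hprod : Integrable (fun p : ℝ × ℝ => k' p.1 • h p.2) (μ.prod μ) := hk'i.smul_prod hh
  have hS : MeasurableSet {p : ℝ × ℝ | p.2 ≤ p.1} := measurableSet_le measurable_snd measurable_fst
  -- `h` is only integrable, so its primitive need not be differentiable everywhere; Fubini on the
  -- triangle `t ≤ x` takes the place of the product rule.
  have hswap := integral_integral_swap
    (f := fun x t => indicator {p : ℝ × ℝ | p.2 ≤ p.1} (fun p => k' p.1 • h p.2) (x, t))
    (μ := μ) (ν := μ) (hprod.indicator hS)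
  have hleft : ∫ x, ∫ t, indicator {p : ℝ × ℝ | p.2 ≤ p.1} (fun p => k' p.1 • h p.2) (x, t) ∂μ ∂μ
      = ∫ x in Ioc 0 ℓ, k' x • ∫ t in (0 : ℝ)..x, h t := by
    refine setIntegral_congr_fun measurableSet_Ioc fun x hx => ?_
    have h1 : ∀ t, indicator {p : ℝ × ℝ | p.2 ≤ p.1} (fun p => k' p.1 • h p.2) (x, t)
        = indicator (Iic x) (fun t => k' x • h t) t := fun t => rfl
    simp only [h1]
    rw [integral_indicator measurableSet_Iic, hμ, Measure.restrict_restrict measurableSet_Iic,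
      intervalIntegral.integral_of_le hx.1.le, integral_smul]
    congr 3
    ext t; simp only [mem_inter_iff, mem_Iic, mem_Ioc]; grind
  have hright : ∫ t, ∫ x, indicator {p : ℝ × ℝ | p.2 ≤ p.1} (fun p => k' p.1 • h p.2) (x, t) ∂μ ∂μ
      = ∫ t in Ioc 0 ℓ, (k ℓ - k t) • h t := by
    refine setIntegral_congr_fun measurableSet_Ioc fun t ht => ?_
    have h1 : ∀ x, indicator {p : ℝ × ℝ | p.2 ≤ p.1} (fun p => k' p.1 • h p.2) (x, t)
        = indicator (Ici t) (fun x => k' x • h t) x := fun x => rfl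
    simp only [h1]
    rw [integral_indicator measurableSet_Ici, hμ, Measure.restrict_restrict measurableSet_Ici,
      integral_smul_const, ← hftc, intervalIntegral.integral_of_le ht.2, ← integral_Icc_eq_integral_Ioc]
    congr 3
    ext x; simp only [mem_inter_iff, mem_Ici, mem_Ioc, mem_Icc]; grind
  rw [hleft, hright] at hswap
  have hkh : Integrable (fun t => k t • h t) μ := by
    obtain ⟨C, hC⟩ := (isCompact_Icc (a := (0 : ℝ)) (b := ℓ)).exists_bound_of_continuousOn
      hkc.continuousOn
    exact hh.bdd_smul C hkc.aestronglyMeasurable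
      ((ae_restrict_iff' measurableSet_Ioc).2 (ae_of_all _ fun x hx => hC x ⟨hx.1.le, hx.2⟩))
  have hrest : ∫ t in Ioc 0 ℓ, (k ℓ - k t) • h t
      = k ℓ • (∫ t in (0 : ℝ)..ℓ, h t) - ∫ x in Ioc 0 ℓ, k x • h x := by
    simp only [sub_smul]
    have hh' : Integrable (fun t => k ℓ • h t) μ := Integrable.smul (k ℓ) hh
    rw [integral_sub hh' hkh, integral_smul, intervalIntegral.integral_of_le hℓ]
  have hprimc : ContinuousOn (fun x => ∫ t in (0 : ℝ)..x, h t) (Icc 0 ℓ) := by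
    have := intervalIntegral.continuousOn_primitive_interval (a := (0 : ℝ)) (b := ℓ) (μ := volume) (f := h)
      (by rw [uIcc_of_le hℓ, integrableOn_Icc_iff_integrableOn_Ioc]; exact hh)
    rwa [uIcc_of_le hℓ] at this
  have hadd : ∫ x in Ioc 0 ℓ, k' x • (B + ∫ t in (0 : ℝ)..x, h t)
      = (k ℓ - k 0) • B + ∫ x in Ioc 0 ℓ, k' x • ∫ t in (0 : ℝ)..x, h t := by
    simp only [smul_add]
    rw [integral_add (hk'i.smul_const B), integral_smul_const, ← hftc,
      intervalIntegral.integral_of_le hℓ]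
    have : ContinuousOn (fun x => k' x • ∫ t in (0 : ℝ)..x, h t) (Icc 0 ℓ) :=
      hk'.continuousOn.smul hprimc
    exact (this.integrableOn_Icc).mono_set Ioc_subset_Icc_self
  rw [hadd, hswap, hrest]
  module

/-- A test function on `(0, ℓ)`. -/
structure IsTest (ℓ : ℝ) (φ : ℝ → ℝ) : Prop where
  contDiff : ContDiff ℝ ∞ φ
  hasCompactSupport : HasCompactSupport φ
  tsupport_subset : tsupport φ ⊆ Ioo 0 ℓ

namespace IsTest

variable {ℓ : ℝ} {φ ψ : ℝ → ℝ}

theorem continuous (h : IsTest ℓ φ) : Continuous φ := h.contDiff.continuous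

theorem hasDerivAt (h : IsTest ℓ φ) (x : ℝ) : HasDerivAt φ (deriv φ x) x :=
  (h.contDiff.differentiable (by simp)).differentiableAt.hasDerivAt

theorem deriv (h : IsTest ℓ φ) : IsTest ℓ (deriv φ) where
  contDiff := (contDiff_infty_iff_deriv.1 h.contDiff).2
  hasCompactSupport := h.hasCompactSupport.deriv
  tsupport_subset := tsupport_deriv_subset.trans h.tsupport_subset

theorem apply_eq_zero (h : IsTest ℓ φ) {x : ℝ} (hx : x ∉ Ioo 0 ℓ) : φ x = 0 :=
  image_eq_zero_of_notMem_tsupport fun h' => hx (h.tsupport_subset h')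

theorem sub_smul (h : IsTest ℓ φ) (h' : IsTest ℓ ψ) (c : ℝ) :
    IsTest ℓ (fun x => φ x - c * ψ x) where
  contDiff := h.contDiff.sub (contDiff_const.mul h'.contDiff)
  hasCompactSupport := h.hasCompactSupport.sub (h'.hasCompactSupport.mul_left)
  tsupport_subset := by
    refine (tsupport_sub _ _).trans (union_subset h.tsupport_subset ?_)
    exact (tsupport_mul_subset_right).trans h'.tsupport_subset

theorem integrable_smul (h : IsTest ℓ φ) {u : ℝ → ℂ} (hu : IntegrableOn u (Ioo 0 ℓ)) :
    IntegrableOn (fun x => φ x • u x) (Ioo 0 ℓ) := by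
  obtain ⟨C, hC⟩ := h.hasCompactSupport.exists_bound_of_continuous h.continuous
  exact Integrable.bdd_smul hu C h.continuous.aestronglyMeasurable (ae_of_all _ hC)

/-- A test function with integral zero is the derivative of a test function. -/
theorem exists_primitive (h : IsTest ℓ φ) (h0 : ∫ x in Ioo 0 ℓ, φ x = 0) :
    ∃ Φ, IsTest ℓ Φ ∧ _root_.deriv Φ = φ := by
  have hd : ∀ x, HasDerivAt (fun x => ∫ t in (0 : ℝ)..x, φ t) (φ x) x := fun x =>
    h.continuous.integral_hasStrictDerivAt 0 x |>.hasDerivAt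
  have hd' : _root_.deriv (fun x => ∫ t in (0 : ℝ)..x, φ t) = φ := funext fun x => (hd x).deriv
  obtain hℓ | hℓ := le_or_gt ℓ 0
  · have hz : φ = 0 := funext fun x => h.apply_eq_zero (by simp [hℓ])
    exact ⟨0, ⟨contDiff_const, .zero, by simp⟩, by rw [hz]; exact deriv_const' 0⟩
  obtain ⟨a, b, ha, hb, hab⟩ : ∃ a b, 0 < a ∧ b < ℓ ∧ tsupport φ ⊆ Icc a b := by
    obtain he | hne := (tsupport φ).eq_empty_or_nonempty
    -- For `φ = 0` any pair with `0 < a` and `b < ℓ` serves; here `Icc ℓ 0` is empty.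
    · exact ⟨ℓ, 0, hℓ, hℓ, by simp [he]⟩
    · have hc : IsCompact (tsupport φ) := h.hasCompactSupport
      exact ⟨_, _, (h.tsupport_subset (hc.sInf_mem hne)).1, (h.tsupport_subset (hc.sSup_mem hne)).2,
        fun x hx => ⟨csInf_le hc.bddBelow hx, le_csSup hc.bddAbove hx⟩⟩
  have hout : ∀ x, x ∉ Icc a b → ∫ t in (0 : ℝ)..x, φ t = 0 := by
    intro x hx
    by_cases hxa : x < a
    · refine (intervalIntegral.integral_congr fun t ht => ?_).trans intervalIntegral.integral_zero
      refine image_eq_zero_of_notMem_tsupport fun h' => ?_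
      have := (hab h').1
      have := ht.2
      have : max 0 x < a := max_lt ha hxa
      simp only [uIcc, mem_Icc] at ht
      linarith [ht.2]
    · have hxb : b < x := by by_contra hxb; exact hx ⟨not_lt.1 hxa, not_lt.1 hxb⟩
      have h1 : ∫ t in (0 : ℝ)..ℓ, φ t = 0 := by
        rw [intervalIntegral.integral_of_le hℓ.le, integral_Ioc_eq_integral_Ioo, h0]
      rw [← intervalIntegral.integral_add_adjacent_intervals
        (h.continuous.intervalIntegrable 0 ℓ) (h.continuous.intervalIntegrable ℓ x), h1, zero_add]
      refine (intervalIntegral.integral_congr fun t ht => ?_).trans intervalIntegral.integral_zero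
      refine image_eq_zero_of_notMem_tsupport fun h' => ?_
      have := (hab h').2
      have : b < min ℓ x := lt_min hb hxb
      simp only [uIcc, mem_Icc] at ht
      linarith [ht.1]
  have hts : tsupport (fun x => ∫ t in (0 : ℝ)..x, φ t) ⊆ Icc a b :=
    closure_minimal (fun x hx => by by_contra h'; exact hx (hout x h')) isClosed_Icc
  refine ⟨_, ⟨?_, ?_, hts.trans fun x hx => ⟨ha.trans_le hx.1, hx.2.trans_lt hb⟩⟩, hd'⟩
  · refine contDiff_infty_iff_deriv.2 ⟨fun x => (hd x).differentiableAt, ?_⟩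
    rw [hd']; exact h.contDiff
  · exact isCompact_Icc.of_isClosed_subset (isClosed_tsupport _) hts

theorem exists_integral_eq_one (hℓ : 0 < ℓ) : ∃ φ, IsTest ℓ φ ∧ ∫ x in Ioo 0 ℓ, φ x = 1 := by
  -- The outer radius `ℓ / 4` around the midpoint keeps the closed support inside `(0, ℓ)`.
  let b : ContDiffBump (ℓ / 2) := ⟨ℓ / 8, ℓ / 4, by positivity, by linarith⟩
  have hs : tsupport (b.normed volume) ⊆ Ioo 0 ℓ := by
    rw [b.tsupport_normed_eq, Real.closedBall_eq_Icc]
    intro x hx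
    have h1 : ℓ / 2 - ℓ / 4 ≤ x := hx.1
    have h2 : x ≤ ℓ / 2 + ℓ / 4 := hx.2
    constructor <;> linarith
  refine ⟨b.normed volume, ⟨b.contDiff_normed, b.hasCompactSupport_normed, hs⟩, ?_⟩
  rw [setIntegral_eq_integral_of_forall_compl_eq_zero, b.integral_normed]
  intro x hx
  exact image_eq_zero_of_notMem_tsupport fun h' => hx (hs h')

end IsTest

/-- The du Bois-Reymond lemma: a function with vanishing weak derivative is constant. -/
theorem ae_eq_const_of_integral_deriv_smul_eq_zero {ℓ : ℝ} (hℓ : 0 < ℓ) {u : ℝ → ℂ}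
    (hu : IntegrableOn u (Ioo 0 ℓ))
    (h : ∀ φ, IsTest ℓ φ → ∫ x in Ioo 0 ℓ, deriv φ x • u x = 0) :
    ∃ c, u =ᵐ[volume.restrict (Ioo 0 ℓ)] fun _ => c := by
  obtain ⟨ψ, hψ, hψ1⟩ := IsTest.exists_integral_eq_one hℓ
  refine ⟨∫ x in Ioo 0 ℓ, ψ x • u x, ?_⟩
  set c := ∫ x in Ioo 0 ℓ, ψ x • u x
  have hint : ∀ {φ}, IsTest ℓ φ → IntegrableOn φ (Ioo 0 ℓ) := fun hφ =>
    hφ.continuous.integrableOn_Ioc.mono_set Ioo_subset_Ioc_self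
  have hc : IntegrableOn (fun _ : ℝ => c) (Ioo 0 ℓ) := integrableOn_const (by simp) (by simp)
  have key := isOpen_Ioo.ae_eq_zero_of_integral_contDiff_smul_eq_zero
    (μ := volume.restrict (Ioo (0 : ℝ) ℓ)) (f := fun x => u x - c) (U := Ioo 0 ℓ)
    (((hu.sub hc).locallyIntegrable).locallyIntegrableOn _) (by
      intro φ h1 h2 h3
      have hφ : IsTest ℓ φ := ⟨h1, h2, h3⟩
      -- Subtracting `(∫ φ) ψ` leaves a test function of mean zero, hence a derivative, to which the
      -- hypothesis applies.
      obtain ⟨Φ, hΦ, hΦ'⟩ := (hφ.sub_smul hψ (∫ x in Ioo 0 ℓ, φ x)).exists_primitive (by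
        rw [integral_sub (hint hφ) ((hint hψ).const_mul _), integral_const_mul, hψ1]; ring)
      have h4 := h Φ hΦ
      rw [hΦ'] at h4
      simp only [_root_.sub_smul, mul_smul] at h4
      have h5 : IntegrableOn (fun x => (∫ x in Ioo 0 ℓ, φ x) • ψ x • u x) (Ioo 0 ℓ) :=
        Integrable.smul (∫ x in Ioo 0 ℓ, φ x) (hψ.integrable_smul hu)
      rw [integral_sub (hφ.integrable_smul hu) h5, integral_smul] at h4
      simp only [smul_sub]
      rw [integral_sub (hφ.integrable_smul hu) (hφ.integrable_smul hc), integral_smul_const]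
      exact h4)
  filter_upwards [key, ae_restrict_mem measurableSet_Ioo] with x h1 h2
  exact sub_eq_zero.1 (h1 h2)

/-! ### Functions in `W^{2,2}` -/

theorem integrableOn_L2 {ℓ : ℝ} (f : L2Interval ℓ) : IntegrableOn f (Ioo 0 ℓ) :=
  (Lp.memLp f).integrable (by norm_num)

theorem memLp_of_continuous {F : ℝ → ℂ} (hF : Continuous F) (ℓ : ℝ) :
    MemLp F 2 (volume.restrict (Ioo 0 ℓ)) := by
  obtain ⟨C, hC⟩ := (isCompact_Icc (a := (0 : ℝ)) (b := ℓ)).exists_bound_of_continuousOn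
    hF.continuousOn
  exact .of_bound hF.aestronglyMeasurable C
    ((ae_restrict_iff' measurableSet_Ioo).2 (ae_of_all _ fun x hx => hC x ⟨hx.1.le, hx.2.le⟩))

/-- `F` is a `C¹` representative of `f` with derivative `G`, and `G` is a primitive of `h` on
`(0, ℓ)`, expressed through integration by parts. -/
structure IsPrimitivePair {ℓ : ℝ} (f h : L2Interval ℓ) (F G : ℝ → ℂ) : Prop where
  continuous : Continuous G
  hasDerivAt : ∀ x, HasDerivAt F (G x) x
  ae_eq : F =ᵐ[volume.restrict (Ioo 0 ℓ)] f
  integral_smul : ∀ k k' : ℝ → ℝ, (∀ x, HasDerivAt k (k' x) x) → Continuous k' →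
    ∫ x in Ioo 0 ℓ, k x • h x = k ℓ • G ℓ - k 0 • G 0 - ∫ x in Ioo 0 ℓ, k' x • G x

/-- Integration by parts for `C¹` functions. -/
theorem integral_smul_deriv {ℓ : ℝ} (hℓ : 0 ≤ ℓ) {k k' : ℝ → ℝ} (hk : ∀ x, HasDerivAt k (k' x) x)
    (hk' : Continuous k') {F G : ℝ → ℂ} (hF : ∀ x, HasDerivAt F (G x) x) (hG : Continuous G) :
    ∫ x in Ioo 0 ℓ, k x • G x = k ℓ • F ℓ - k 0 • F 0 - ∫ x in Ioo 0 ℓ, k' x • F x := by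
  rw [← integral_Ioc_eq_integral_Ioo, ← integral_Ioc_eq_integral_Ioo,
    ← intervalIntegral.integral_of_le hℓ, ← intervalIntegral.integral_of_le hℓ]
  exact intervalIntegral.integral_smul_deriv_eq_deriv_smul (fun x _ => hk x) (fun x _ => hF x)
    (hk'.intervalIntegrable _ _) (hG.intervalIntegrable _ _)

/-- `h` is the second weak derivative of `f`, tested against twice differentiated functions. -/
def HasVeryWeakDeriv {ℓ : ℝ} (f h : L2Interval ℓ) : Prop :=
  ∀ φ, IsTest ℓ φ → ∫ x in Ioo 0 ℓ, deriv (deriv φ) x • f x = ∫ x in Ioo 0 ℓ, φ x • h x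

theorem HasSecondDeriv.hasVeryWeakDeriv {ℓ : ℝ} {f h : L2Interval ℓ} (hf : HasSecondDeriv f h) :
    HasVeryWeakDeriv f h := by
  obtain ⟨g, h1, h2⟩ := hf
  intro φ hφ
  rw [h1 _ hφ.deriv.contDiff hφ.deriv.hasCompactSupport hφ.deriv.tsupport_subset,
    h2 _ hφ.contDiff hφ.hasCompactSupport hφ.tsupport_subset, neg_neg]

theorem integral_congr_smul {ℓ : ℝ} {F F' : ℝ → ℂ} (h : F =ᵐ[volume.restrict (Ioo 0 ℓ)] F')
    (k : ℝ → ℝ) : ∫ x in Ioo 0 ℓ, k x • F x = ∫ x in Ioo 0 ℓ, k x • F' x :=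
  integral_congr_ae (h.mono fun x hx => by simp only [hx])

/-- The class of `G` serves as the intermediate weak derivative: test functions vanish at both ends,
so no boundary terms remain. -/
theorem IsPrimitivePair.hasSecondDeriv {ℓ : ℝ} (hℓ : 0 < ℓ) {f h : L2Interval ℓ} {F G : ℝ → ℂ}
    (hFG : IsPrimitivePair f h F G) : HasSecondDeriv f h := by
  have hG := (memLp_of_continuous hFG.continuous ℓ).coeFn_toLp
  refine ⟨(memLp_of_continuous hFG.continuous ℓ).toLp, ?_, ?_⟩ <;> intro φ h1 h2 h3 <;>
    have hφ : IsTest ℓ φ := ⟨h1, h2, h3⟩ <;>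
    have e0 : φ 0 = 0 := hφ.apply_eq_zero (by simp) <;>
    have el : φ ℓ = 0 := hφ.apply_eq_zero (by simp) <;>
    rw [integral_congr_smul hG]
  · have := integral_smul_deriv hℓ.le hφ.hasDerivAt hφ.deriv.continuous hFG.hasDerivAt
      hFG.continuous
    rw [← integral_congr_smul hFG.ae_eq, this, e0, el]
    simp
  · rw [hFG.integral_smul φ _ hφ.hasDerivAt hφ.deriv.continuous, e0, el]
    simp

/-- Subtract from `f` a double primitive `F0` of `h`. The difference `u` annihilates all second
derivatives of test functions, so it is affine by two applications of the du Bois-Reymond argument,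
and `F` is `F0` plus an affine function. -/
theorem HasVeryWeakDeriv.exists_isPrimitivePair {ℓ : ℝ} (hℓ : 0 < ℓ) {f h : L2Interval ℓ}
    (hf : HasVeryWeakDeriv f h) : ∃ F G, IsPrimitivePair f h F G := by
  -- Extending `h` by zero makes the primitives defined, and `F0` differentiable, on all of `ℝ`, so
  -- no one-sided derivatives are needed at the endpoints.
  have hh : Integrable (indicator (Ioo 0 ℓ) h) :=
    (integrable_indicator_iff measurableSet_Ioo).2 (integrableOn_L2 h)
  set G0 : ℝ → ℂ := fun x => ∫ t in (0 : ℝ)..x, indicator (Ioo 0 ℓ) h t with hG0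
  have hG0c : Continuous G0 := intervalIntegral.continuous_primitive
    (fun a b => hh.intervalIntegrable) 0
  set F0 : ℝ → ℂ := fun x => ∫ t in (0 : ℝ)..x, G0 t with hF0
  have hF0d : ∀ x, HasDerivAt F0 (G0 x) x := fun x =>
    (hG0c.integral_hasStrictDerivAt 0 x).hasDerivAt
  have hF0c : Continuous F0 := continuous_iff_continuousAt.2 fun x => (hF0d x).continuousAt
  have hcont : ∀ {F : ℝ → ℂ}, Continuous F → IntegrableOn F (Ioo 0 ℓ) := fun hF =>
    hF.integrableOn_Ioc.mono_set Ioo_subset_Ioc_self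
  have hparts : ∀ (B : ℂ) (k k' : ℝ → ℝ), (∀ x, HasDerivAt k (k' x) x) → Continuous k' →
      ∫ x in Ioo 0 ℓ, k x • h x =
        k ℓ • (B + G0 ℓ) - k 0 • B - ∫ x in Ioo 0 ℓ, k' x • (B + G0 x) := by
    intro B k k' hk hk'
    rw [← integral_Ioc_eq_integral_Ioo (f := fun x => k' x • (B + G0 x)),
      ← integral_smul_eq_sub_of_primitive hℓ.le hk hk' hh.integrableOn B,
      integral_Ioc_eq_integral_Ioo]
    refine setIntegral_congr_fun measurableSet_Ioo fun x hx => ?_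
    simp only [indicator_of_mem hx]
  set u : ℝ → ℂ := fun x => f x - F0 x with hu
  have hui : IntegrableOn u (Ioo 0 ℓ) := (integrableOn_L2 f).sub (hcont hF0c)
  have hu2 : ∀ φ, IsTest ℓ φ → ∫ x in Ioo 0 ℓ, deriv (deriv φ) x • u x = 0 := by
    intro φ hφ
    simp only [hu, smul_sub]
    rw [integral_sub (hφ.deriv.deriv.integrable_smul (integrableOn_L2 f))
      (hφ.deriv.deriv.integrable_smul (hcont hF0c)), hf φ hφ,
      hparts 0 φ _ hφ.hasDerivAt hφ.deriv.continuous]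
    have := integral_smul_deriv hℓ.le hφ.deriv.hasDerivAt hφ.deriv.deriv.continuous hF0d hG0c
    simp only [zero_add]
    rw [this, hφ.apply_eq_zero (x := 0) (by simp), hφ.apply_eq_zero (x := ℓ) (by simp),
      hφ.deriv.apply_eq_zero (x := 0) (by simp), hφ.deriv.apply_eq_zero (x := ℓ) (by simp)]
    simp
  obtain ⟨ψ, hψ, hψ1⟩ := IsTest.exists_integral_eq_one hℓ
  set c := ∫ x in Ioo 0 ℓ, deriv ψ x • u x with hc
  have hint : ∀ {φ}, IsTest ℓ φ → IntegrableOn φ (Ioo 0 ℓ) := fun hφ =>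
    hφ.continuous.integrableOn_Ioc.mono_set Ioo_subset_Ioc_self
  -- This says that the weak derivative of `u` is the constant `-c`, so that `u + c x` has vanishing
  -- weak derivative.
  have hu1 : ∀ φ, IsTest ℓ φ → ∫ x in Ioo 0 ℓ, deriv φ x • u x = (∫ x in Ioo 0 ℓ, φ x) • c := by
    intro φ hφ
    have hφψ := hφ.sub_smul hψ (∫ x in Ioo 0 ℓ, φ x)
    obtain ⟨Φ, hΦ, hΦ'⟩ := hφψ.exists_primitive (by
        rw [integral_sub (hint hφ) ((hint hψ).const_mul _), integral_const_mul, hψ1]; ring)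
    have h4 := hu2 Φ hΦ
    have h6 : deriv (deriv Φ) = fun x => deriv φ x - (∫ x in Ioo 0 ℓ, φ x) * deriv ψ x := by
      rw [hΦ']
      funext x
      exact ((hφ.hasDerivAt x).sub ((hψ.hasDerivAt x).const_mul _)).deriv
    rw [h6] at h4
    simp only [_root_.sub_smul, mul_smul] at h4
    have h5 : IntegrableOn (fun x => (∫ x in Ioo 0 ℓ, φ x) • deriv ψ x • u x) (Ioo 0 ℓ) :=
      Integrable.smul (∫ x in Ioo 0 ℓ, φ x) (hψ.deriv.integrable_smul hui)
    rw [integral_sub (hφ.deriv.integrable_smul hui) h5, integral_smul] at h4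
    exact sub_eq_zero.1 h4
  have hlin : ∀ x : ℝ, HasDerivAt (fun x : ℝ => (x : ℂ) * c) c x := fun x => by
    simpa using (Complex.ofRealCLM.hasDerivAt (x := x)).mul_const c
  have hlinc : Continuous fun x : ℝ => (x : ℂ) * c := by fun_prop
  obtain ⟨d, hd⟩ := ae_eq_const_of_integral_deriv_smul_eq_zero hℓ (u := fun x => u x + (x : ℂ) * c)
    (hui.add (hcont hlinc)) (by
      intro φ hφ
      simp only [smul_add]
      rw [integral_add (hφ.deriv.integrable_smul hui) (hφ.deriv.integrable_smul (hcont hlinc)),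
        hu1 φ hφ]
      have := integral_smul_deriv hℓ.le hφ.hasDerivAt hφ.deriv.continuous hlin continuous_const
      rw [hφ.apply_eq_zero (x := 0) (by simp), hφ.apply_eq_zero (x := ℓ) (by simp),
        integral_smul_const] at this
      rw [this]; simp)
  refine ⟨fun x => F0 x - (x : ℂ) * c + d, fun x => -c + G0 x, by fun_prop, fun x => ?_, ?_, ?_⟩
  · exact (((hF0d x).sub (hlin x)).add_const d).congr_deriv (neg_add_eq_sub _ _).symm
  · filter_upwards [hd] with x hx
    simp only [hu] at hx
    rw [← hx]; ring
  · intro k k' hk hk'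
    rw [hparts (-c) k k' hk hk']
    simp [hG0]

/-! ### Green's formula on an edge -/

section Green

variable {ℓ : ℝ} {f h : L2Interval ℓ} {F G : ℝ → ℂ}

theorem IsPrimitivePair.continuous_fst (hFG : IsPrimitivePair f h F G) : Continuous F :=
  continuous_iff_continuousAt.2 fun x => (hFG.hasDerivAt x).continuousAt

theorem IsPrimitivePair.green (hFG : IsPrimitivePair f h F G) (hℓ : 0 ≤ ℓ) {k k' k'' : ℝ → ℝ}
    (hk : ∀ x, HasDerivAt k (k' x) x) (hk' : ∀ x, HasDerivAt k' (k'' x) x)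
    (hk'' : Continuous k'') : ∫ x in Ioo 0 ℓ, k x • h x =
      k ℓ • G ℓ - k 0 • G 0 - (k' ℓ • F ℓ - k' 0 • F 0) + ∫ x in Ioo 0 ℓ, k'' x • f x := by
  have hc : Continuous k' := continuous_iff_continuousAt.2 fun x => (hk' x).continuousAt
  rw [hFG.integral_smul k k' hk hc, integral_smul_deriv hℓ hk' hk'' hFG.hasDerivAt hFG.continuous,
    ← integral_congr_smul hFG.ae_eq]
  ring

variable {t : ℝ → ℝ} {s : ℝ}

/-- The kernel `k = t (1 - t)²` vanishes where `t` is `0` or `1`, which removes the derivatives of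
`F`; `k'` equals `s` where `t = 0` and vanishes where `t = 1`, which isolates the value of `F` at
the end with `t = 0`. -/
theorem IsPrimitivePair.green_value (hFG : IsPrimitivePair f h F G) (hℓ : 0 ≤ ℓ)
    (ht : ∀ x, HasDerivAt t s x) (ht0 : t 0 = 0 ∨ t 0 = 1) (htl : t ℓ = 0 ∨ t ℓ = 1) :
    ((s ^ 2 : ℝ) : ℂ) * (∫ x in Ioo 0 ℓ, (4 - 6 * t x) • f x) +
      ∫ x in Ioo 0 ℓ, (t x * (1 - t x) ^ 2) • h x =
    (s * (1 - t 0)) • F 0 - (s * (1 - t ℓ)) • F ℓ := by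
  have hc : Continuous t := continuous_iff_continuousAt.2 fun x => (ht x).continuousAt
  have h1 := hFG.green hℓ (k := fun x => t x * (1 - t x) ^ 2)
    (k' := fun x => s * (1 - 4 * t x + 3 * t x ^ 2)) (k'' := fun x => (-s ^ 2) * (4 - 6 * t x))
    (fun x => ((ht x).mul (((ht x).const_sub 1).pow 2)).congr_deriv (by simp; ring))
    (fun x => (((((ht x).const_mul 4).const_sub 1).add
      (((ht x).pow 2).const_mul 3)).const_mul s).congr_deriv (by simp; ring)) (by fun_prop)
  rw [h1]
  simp only [mul_smul (-s ^ 2)]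
  rw [MeasureTheory.integral_smul]
  rcases ht0 with h0 | h0 <;> rcases htl with hl | hl <;> rw [h0, hl] <;> norm_num

/-- An affine kernel has no second derivative, so `f` enters only through its end values. The
difference quotient that appears is the correction term built into the second boundary map. -/
theorem IsPrimitivePair.green_deriv (hFG : IsPrimitivePair f h F G) (hℓ : 0 ≤ ℓ)
    (ht : ∀ x, HasDerivAt t s x) :
    ∫ x in Ioo 0 ℓ, (1 - t x) • h x = (1 - t ℓ) • G ℓ - (1 - t 0) • G 0 + s • (F ℓ - F 0) := by
  have h1 := hFG.green hℓ (k := fun x => 1 - t x) (k' := fun x => -s) (k'' := fun x => 0)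
    (fun x => (ht x).const_sub 1) (fun x => hasDerivAt_const _ _) continuous_const
  rw [h1]
  simp; ring

theorem IsPrimitivePair.of_deriv (hℓ : 0 ≤ ℓ) {H : ℝ → ℂ} (hF : ∀ x, HasDerivAt F (G x) x)
    (hG : ∀ x, HasDerivAt G (H x) x) (hH : Continuous H)
    (hf : F =ᵐ[volume.restrict (Ioo 0 ℓ)] f) (hh : H =ᵐ[volume.restrict (Ioo 0 ℓ)] h) :
    IsPrimitivePair f h F G where
  continuous := continuous_iff_continuousAt.2 fun x => (hG x).continuousAt
  hasDerivAt := hF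
  ae_eq := hf
  integral_smul k k' hk hk' := by
    rw [← integral_congr_smul hh, integral_smul_deriv hℓ hk hk' hG hH]

end Green

/-! ### Weighted integrals of square integrable functions -/

section Pairing

variable {ℓ : ℝ}

theorem integrable_smul_of_continuous {k : ℝ → ℝ} (hk : Continuous k) {u : ℝ → ℂ}
    (hu : IntegrableOn u (Ioo 0 ℓ)) : IntegrableOn (fun x => k x • u x) (Ioo 0 ℓ) := by
  obtain ⟨C, hC⟩ := (isCompact_Icc (a := (0 : ℝ)) (b := ℓ)).exists_bound_of_continuousOn
    hk.continuousOn
  exact Integrable.bdd_smul hu C hk.aestronglyMeasurable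
    ((ae_restrict_iff' measurableSet_Ioo).2 (ae_of_all _ fun x hx => hC x ⟨hx.1.le, hx.2.le⟩))

theorem integral_norm_L2_le (hℓ : 0 ≤ ℓ) (f : L2Interval ℓ) :
    ∫ x in Ioo 0 ℓ, ‖f x‖ ≤ √ℓ * ‖f‖ := by
  have h1 := eLpNorm_le_eLpNorm_mul_rpow_measure_univ (p := 1) (q := 2)
    (μ := volume.restrict (Ioo 0 ℓ)) (by norm_num) (Lp.memLp f).aestronglyMeasurable
  rw [Measure.restrict_apply_univ, Real.volume_Ioo, sub_zero] at h1
  have h2 : (ENNReal.ofReal ℓ) ^ (1 / (1 : ℝ≥0∞).toReal - 1 / (2 : ℝ≥0∞).toReal) =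
      ENNReal.ofReal √ℓ := by
    rw [Real.sqrt_eq_rpow, ENNReal.ofReal_rpow_of_nonneg hℓ (by norm_num)]
    norm_num
  rw [h2, eLpNorm_one_eq_lintegral_enorm] at h1
  rw [integral_norm_eq_lintegral_enorm (Lp.memLp f).aestronglyMeasurable, Lp.norm_def]
  have h3 := ENNReal.toReal_mono (ENNReal.mul_ne_top (Lp.eLpNorm_ne_top f) ENNReal.ofReal_ne_top) h1
  rw [ENNReal.toReal_mul, ENNReal.toReal_ofReal (Real.sqrt_nonneg _)] at h3
  linarith

/-- The functional `f ↦ ∫ k f` on `L²(0, ℓ)`. -/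
def pairing {k : ℝ → ℝ} (hk : Continuous k) : L2Interval ℓ →ₗ[ℂ] ℂ where
  toFun f := ∫ x in Ioo 0 ℓ, k x • f x
  map_add' f g := by
    rw [← integral_add (integrable_smul_of_continuous hk (integrableOn_L2 f))
      (integrable_smul_of_continuous hk (integrableOn_L2 g))]
    apply integral_congr_ae
    filter_upwards [Lp.coeFn_add f g] with x hx
    rw [hx, Pi.add_apply, smul_add]
  map_smul' c f := integral_smul_smul k c f

theorem norm_pairing_le (hℓ : 0 ≤ ℓ) {k : ℝ → ℝ} (hk : Continuous k) {C : ℝ}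
    (hC : ∀ x ∈ Icc 0 ℓ, |k x| ≤ C) (f : L2Interval ℓ) : ‖pairing hk f‖ ≤ C * (√ℓ * ‖f‖) := by
  have hC0 : 0 ≤ C := (abs_nonneg _).trans (hC 0 ⟨le_rfl, hℓ⟩)
  calc ‖pairing hk f‖ ≤ ∫ x in Ioo 0 ℓ, ‖k x • f x‖ := norm_integral_le_integral_norm _
    _ ≤ ∫ x in Ioo 0 ℓ, C * ‖f x‖ := by
        refine setIntegral_mono_on (integrable_smul_of_continuous hk (integrableOn_L2 f)).norm
          ((integrableOn_L2 f).norm.const_mul C) measurableSet_Ioo fun x hx => ?_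
        rw [norm_smul, Real.norm_eq_abs]
        gcongr
        exact hC x ⟨hx.1.le, hx.2.le⟩
    _ = C * ∫ x in Ioo 0 ℓ, ‖f x‖ := integral_const_mul _ _
    _ ≤ _ := by gcongr; exact integral_norm_L2_le hℓ f

theorem continuous_pairing (hℓ : 0 ≤ ℓ) {k : ℝ → ℝ} (hk : Continuous k) :
    Continuous (pairing (ℓ := ℓ) hk) := by
  obtain ⟨C, hC⟩ := (isCompact_Icc (a := (0 : ℝ)) (b := ℓ)).exists_bound_of_continuousOn
    hk.continuousOn
  exact AddMonoidHomClass.continuous_of_bound (pairing hk) (C * √ℓ) fun f => by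
    rw [mul_assoc]; exact norm_pairing_le hℓ hk hC f

/-- Closedness is not visible while an intermediate derivative is quantified over. The formulation
with two derivatives on the test function removes it and leaves an intersection of equalizers of
continuous functionals. -/
theorem isClosed_hasSecondDeriv (hℓ : 0 < ℓ) :
    IsClosed {p : L2Interval ℓ × L2Interval ℓ | HasSecondDeriv p.1 p.2} := by
  have : {p : L2Interval ℓ × L2Interval ℓ | HasSecondDeriv p.1 p.2} =
      ⋂ (φ) (hφ : IsTest ℓ φ), {p : L2Interval ℓ × L2Interval ℓ |
        pairing hφ.deriv.deriv.continuous p.1 = pairing hφ.continuous p.2} := by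
    ext p
    simp only [mem_ofPred_eq, mem_iInter]
    refine ⟨fun hp φ hφ => hp.hasVeryWeakDeriv φ hφ, fun hp => ?_⟩
    have h1 : HasVeryWeakDeriv p.1 p.2 := hp
    obtain ⟨F, G, hFG⟩ := h1.exists_isPrimitivePair hℓ
    exact hFG.hasSecondDeriv hℓ
  rw [this]
  exact isClosed_iInter fun φ => isClosed_iInter fun hφ => isClosed_eq
    ((continuous_pairing hℓ.le _).comp continuous_fst)
    ((continuous_pairing hℓ.le _).comp continuous_snd)

end Pairing

/-! ### Hilbert sums -/

section HilbertSum

variable {ι : Type*} {X : ι → Type*} [∀ i, NormedAddCommGroup (X i)]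

theorem memℓp_two_iff {f : ∀ i, X i} : Memℓp f 2 ↔ Summable fun i => ‖f i‖ ^ 2 := by
  rw [memℓp_gen_iff (by simp)]
  simp

theorem summable_norm_sq (f : lp X 2) : Summable fun i => ‖f i‖ ^ 2 :=
  memℓp_two_iff.1 (lp.memℓp f)

theorem continuous_lp_apply (i : ι) : Continuous fun f : lp X 2 => f i :=
  (lp.lipschitzWith_one_eval 2 i).continuous

variable [∀ i, NormedSpace ℂ (X i)] [∀ i, CompleteSpace (X i)] {E : Type*} [NormedAddCommGroup E] [NormedSpace ℂ E]
  [CompleteSpace E]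

/-- A linear map into a Hilbert sum whose components are continuous is continuous, by the closed
graph theorem. -/
def lpOfComponents (T : E →ₗ[ℂ] ∀ i, X i) (hT : ∀ w, Memℓp (T w) 2)
    (hc : ∀ i, Continuous fun w => T w i) : E →L[ℂ] lp X 2 where
  toFun w := ⟨T w, hT w⟩
  map_add' w w' := lp.ext (T.map_add w w')
  map_smul' c w := lp.ext (T.map_smul c w)
  cont := by
    let T' : E →ₗ[ℂ] lp X 2 :=
      { toFun := fun w => ⟨T w, hT w⟩
        map_add' := fun w w' => lp.ext (T.map_add w w')
        map_smul' := fun c w => lp.ext (T.map_smul c w) }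
    refine T'.continuous_of_isClosed_graph ?_
    have : (T'.graph : Set (E × lp X 2)) = ⋂ i, {p | p.2 i = T p.1 i} := by
      ext p
      simp only [SetLike.mem_coe, LinearMap.mem_graph_iff, mem_iInter, mem_ofPred_eq]
      refine ⟨fun hp i => by rw [hp]; rfl, fun hp => lp.ext (funext hp)⟩
    rw [this]
    exact isClosed_iInter fun i => isClosed_eq ((continuous_lp_apply i).comp continuous_snd)
      ((hc i).comp continuous_fst)

end HilbertSum

/-! ### A right inverse of the boundary maps on an edge -/

section Lift

/-- The class in `L²(0, ℓ)` of a continuous function. -/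
def contToL2 (ℓ : ℝ) {F : ℝ → ℂ} (hF : Continuous F) : L2Interval ℓ :=
  (memLp_of_continuous hF ℓ).toLp

theorem contToL2_ae_eq (ℓ : ℝ) {F : ℝ → ℂ} (hF : Continuous F) :
    F =ᵐ[volume.restrict (Ioo 0 ℓ)] contToL2 ℓ hF :=
  (memLp_of_continuous hF ℓ).coeFn_toLp.symm

theorem norm_contToL2_le {ℓ : ℝ} (hℓ : 0 ≤ ℓ) {F : ℝ → ℂ} (hF : Continuous F) {C : ℝ}
    (hC : ∀ x ∈ Icc 0 ℓ, ‖F x‖ ≤ C) : ‖contToL2 ℓ hF‖ ≤ √ℓ * C := by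
  have hC0 : 0 ≤ C := (norm_nonneg _).trans (hC 0 ⟨le_rfl, hℓ⟩)
  have h1 := eLpNorm_le_of_ae_bound (p := 2) (f := F) (C := C)
    ((ae_restrict_iff' (measurableSet_Ioo (a := (0 : ℝ)) (b := ℓ))).2
      (ae_of_all volume fun x hx => hC x ⟨hx.1.le, hx.2.le⟩))
  rw [Measure.restrict_apply_univ, Real.volume_Ioo, sub_zero,
    ENNReal.ofReal_rpow_of_nonneg hℓ (by simp)] at h1
  have h2 := ENNReal.toReal_mono (ENNReal.mul_ne_top ENNReal.ofReal_ne_top ENNReal.ofReal_ne_top) h1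
  rw [ENNReal.toReal_mul, ENNReal.toReal_ofReal (by positivity), ENNReal.toReal_ofReal hC0] at h2
  rw [contToL2, Lp.norm_toLp, Real.sqrt_eq_rpow]
  convert h2 using 3
  norm_num

/-- The cubic polynomial with boundary data `c 0, c 1` under the first and `c 2, c 3` under the
second boundary map on the edge `(0, ℓ)`. -/
def liftFun (ℓ : ℝ) (c : Fin 4 → ℂ) (x : ℝ) : ℂ :=
  ((√ℓ : ℝ) : ℂ)⁻¹ * (c 0 * (1 - (x / ℓ : ℝ)) + c 1 * (x / ℓ : ℝ) +
    (ℓ : ℂ) ^ 2 * (c 2 * ((x / ℓ : ℝ) * (1 - (x / ℓ : ℝ)) ^ 2) +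
      c 3 * ((x / ℓ : ℝ) ^ 2 * (1 - (x / ℓ : ℝ)))))

/-- The derivative of `liftFun`. -/
def liftDeriv (ℓ : ℝ) (c : Fin 4 → ℂ) (x : ℝ) : ℂ :=
  ((√ℓ : ℝ) : ℂ)⁻¹ * ((ℓ : ℂ)⁻¹ * (c 1 - c 0) +
    (ℓ : ℂ) * (c 2 * (1 - 4 * (x / ℓ : ℝ) + 3 * (x / ℓ : ℝ) ^ 2) +
      c 3 * (2 * (x / ℓ : ℝ) - 3 * (x / ℓ : ℝ) ^ 2)))

/-- The negative of the second derivative of `liftFun`. -/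
def liftNegDeriv2 (ℓ : ℝ) (c : Fin 4 → ℂ) (x : ℝ) : ℂ :=
  ((√ℓ : ℝ) : ℂ)⁻¹ * (c 2 * (4 - 6 * (x / ℓ : ℝ)) + c 3 * (6 * (x / ℓ : ℝ) - 2))

theorem continuous_liftFun (ℓ : ℝ) (c : Fin 4 → ℂ) : Continuous (liftFun ℓ c) := by
  unfold liftFun; fun_prop

theorem continuous_liftNegDeriv2 (ℓ : ℝ) (c : Fin 4 → ℂ) : Continuous (liftNegDeriv2 ℓ c) := by
  unfold liftNegDeriv2; fun_prop

theorem hasDerivAt_ofReal_div (ℓ x : ℝ) :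
    HasDerivAt (fun x : ℝ => ((x / ℓ : ℝ) : ℂ)) ((ℓ : ℂ)⁻¹) x := by
  have := ((hasDerivAt_id x).div_const ℓ).ofReal_comp
  simpa using this

theorem hasDerivAt_liftFun {ℓ : ℝ} (hℓ : 0 < ℓ) (c : Fin 4 → ℂ) (x : ℝ) :
    HasDerivAt (liftFun ℓ c) (liftDeriv ℓ c x) x := by
  have ht := hasDerivAt_ofReal_div ℓ x
  have hℓ' : (ℓ : ℂ) ≠ 0 := by exact_mod_cast hℓ.ne'
  refine HasDerivAt.congr_deriv (((((ht.const_sub 1).const_mul (c 0)).add (ht.const_mul (c 1))).add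
    ((((ht.mul ((ht.const_sub 1).pow 2)).const_mul (c 2)).add
      (((ht.pow 2).mul (ht.const_sub 1)).const_mul (c 3))).const_mul ((ℓ : ℂ) ^ 2))).const_mul
        ((√ℓ : ℝ) : ℂ)⁻¹) ?_
  simp only [liftDeriv]
  congr 1
  simp [-Complex.ofReal_div]
  generalize ((x / ℓ : ℝ) : ℂ) = t
  field_simp
  ring

theorem hasDerivAt_liftDeriv {ℓ : ℝ} (hℓ : 0 < ℓ) (c : Fin 4 → ℂ) (x : ℝ) :
    HasDerivAt (liftDeriv ℓ c) (-liftNegDeriv2 ℓ c x) x := by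
  have ht := hasDerivAt_ofReal_div ℓ x
  have hℓ' : (ℓ : ℂ) ≠ 0 := by exact_mod_cast hℓ.ne'
  refine HasDerivAt.congr_deriv ((((((((ht.const_mul 4).const_sub 1).add
    ((ht.pow 2).const_mul 3)).const_mul (c 2)).add
      (((ht.const_mul 2).sub ((ht.pow 2).const_mul 3)).const_mul (c 3))).const_mul
        (ℓ : ℂ)).const_add ((ℓ : ℂ)⁻¹ * (c 1 - c 0))).const_mul ((√ℓ : ℝ) : ℂ)⁻¹) ?_
  simp only [liftNegDeriv2]
  rw [← mul_neg]
  simp [-Complex.ofReal_div]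
  generalize ((x / ℓ : ℝ) : ℂ) = t
  field_simp
  ring

/-- The class of `liftFun`, as a linear function of the boundary data. -/
def edgeLift (ℓ : ℝ) : (Fin 4 → ℂ) →ₗ[ℂ] L2Interval ℓ where
  toFun c := contToL2 ℓ (continuous_liftFun ℓ c)
  map_add' c d := by
    rw [contToL2, contToL2, contToL2, ← MemLp.toLp_add]
    refine MemLp.toLp_congr _ _ (ae_of_all _ fun x => ?_)
    simp only [liftFun, Pi.add_apply]; ring
  map_smul' a c := by
    rw [contToL2, contToL2, RingHom.id_apply, ← MemLp.toLp_const_smul]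
    refine MemLp.toLp_congr _ _ (ae_of_all _ fun x => ?_)
    simp only [liftFun, Pi.smul_apply, smul_eq_mul]; ring

/-- The class of `liftNegDeriv2`, as a linear function of the boundary data. -/
def edgeLiftImage (ℓ : ℝ) : (Fin 4 → ℂ) →ₗ[ℂ] L2Interval ℓ where
  toFun c := contToL2 ℓ (continuous_liftNegDeriv2 ℓ c)
  map_add' c d := by
    rw [contToL2, contToL2, contToL2, ← MemLp.toLp_add]
    refine MemLp.toLp_congr _ _ (ae_of_all _ fun x => ?_)
    simp only [liftNegDeriv2, Pi.add_apply]; ring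
  map_smul' a c := by
    rw [contToL2, contToL2, RingHom.id_apply, ← MemLp.toLp_const_smul]
    refine MemLp.toLp_congr _ _ (ae_of_all _ fun x => ?_)
    simp only [liftNegDeriv2, Pi.smul_apply, smul_eq_mul]; ring

theorem isPrimitivePair_lift {ℓ : ℝ} (hℓ : 0 < ℓ) (c : Fin 4 → ℂ) :
    IsPrimitivePair (edgeLift ℓ c) (-edgeLiftImage ℓ c) (liftFun ℓ c) (liftDeriv ℓ c) := by
  refine .of_deriv hℓ.le (hasDerivAt_liftFun hℓ c) (hasDerivAt_liftDeriv hℓ c)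
    (continuous_liftNegDeriv2 ℓ c).neg (contToL2_ae_eq ℓ (continuous_liftFun ℓ c)) ?_
  exact (contToL2_ae_eq ℓ (continuous_liftNegDeriv2 ℓ c)).neg.trans (Lp.coeFn_neg _).symm

/-- The prefactor `ℓ^(-1/2)` of the cubic cancels the factor `√ℓ` lost in passing from the supremum
norm to `L²`. The bound is therefore uniform over edges of bounded length, however short. -/
theorem norm_edgeLift_le {ℓ : ℝ} (hℓ : 0 < ℓ) (c : Fin 4 → ℂ) :
    ‖edgeLift ℓ c‖ ≤ ‖c 0‖ + ‖c 1‖ + ℓ ^ 2 * (‖c 2‖ + ‖c 3‖) := by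
  have hs : 0 < √ℓ := Real.sqrt_pos.2 hℓ
  have := norm_contToL2_le hℓ.le (continuous_liftFun ℓ c)
    (C := (√ℓ)⁻¹ * (‖c 0‖ + ‖c 1‖ + ℓ ^ 2 * (‖c 2‖ + ‖c 3‖))) (fun x hx => by
      have h0 : 0 ≤ x / ℓ := div_nonneg hx.1 hℓ.le
      have h1 : x / ℓ ≤ 1 := (div_le_one hℓ).2 hx.2
      have hn : ∀ r : ℝ, 0 ≤ r → r ≤ 1 → ∀ z : ℂ, ‖z * (r : ℂ)‖ ≤ ‖z‖ := fun r hr hr1 z => by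
        rw [norm_mul, Complex.norm_real, Real.norm_eq_abs, abs_of_nonneg hr]
        exact mul_le_of_le_one_right (norm_nonneg _) hr1
      generalize hxt : x / ℓ = t at h0 h1
      rw [liftFun, hxt, norm_mul, norm_inv, Complex.norm_real, Real.norm_eq_abs, abs_of_pos hs]
      gcongr
      refine (norm_add_le _ _).trans (add_le_add ((norm_add_le _ _).trans (add_le_add ?_ ?_)) ?_)
      · exact_mod_cast hn (1 - t) (by linarith) (by linarith) (c 0)
      · exact hn t h0 h1 (c 1)
      · rw [norm_mul, norm_pow, Complex.norm_real, Real.norm_eq_abs, abs_of_pos hℓ]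
        gcongr
        refine (norm_add_le _ _).trans (add_le_add ?_ ?_)
        · have h2 : (1 - t) ^ 2 ≤ 1 := by nlinarith
          exact_mod_cast hn (t * (1 - t) ^ 2) (by positivity)
            (mul_le_one₀ h1 (by positivity) h2) (c 2)
        · have h2 : t ^ 2 ≤ 1 := by nlinarith
          exact_mod_cast hn (t ^ 2 * (1 - t)) (mul_nonneg (by positivity) (by linarith))
            (mul_le_one₀ h2 (by linarith) (by linarith)) (c 3))
  rwa [← mul_assoc, mul_inv_cancel₀ hs.ne', one_mul] at this

theorem norm_edgeLiftImage_le {ℓ : ℝ} (hℓ : 0 < ℓ) (c : Fin 4 → ℂ) :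
    ‖edgeLiftImage ℓ c‖ ≤ 4 * (‖c 2‖ + ‖c 3‖) := by
  have hs : 0 < √ℓ := Real.sqrt_pos.2 hℓ
  have := norm_contToL2_le hℓ.le (continuous_liftNegDeriv2 ℓ c)
    (C := (√ℓ)⁻¹ * (4 * (‖c 2‖ + ‖c 3‖))) (fun x hx => by
      have h0 : 0 ≤ x / ℓ := div_nonneg hx.1 hℓ.le
      have h1 : x / ℓ ≤ 1 := (div_le_one hℓ).2 hx.2
      have hn : ∀ r : ℝ, |r| ≤ 4 → ∀ z : ℂ, ‖z * (r : ℂ)‖ ≤ 4 * ‖z‖ := fun r hr z => by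
        rw [norm_mul, Complex.norm_real, Real.norm_eq_abs, mul_comm]
        gcongr
      generalize hxt : x / ℓ = t at h0 h1
      rw [liftNegDeriv2, hxt, norm_mul, norm_inv, Complex.norm_real, Real.norm_eq_abs,
        abs_of_pos hs, mul_add]
      gcongr
      refine (norm_add_le _ _).trans (add_le_add ?_ ?_)
      · exact_mod_cast hn (4 - 6 * t) (abs_le.2 ⟨by linarith, by linarith⟩) (c 2)
      · exact_mod_cast hn (6 * t - 2) (abs_le.2 ⟨by linarith, by linarith⟩) (c 3))
  rwa [← mul_assoc, mul_inv_cancel₀ hs.ne', one_mul] at this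

end Lift

namespace MetricGraph

variable {V : Type*} {G : SimpleGraph V} (M : MetricGraph G)

/-! ### Edges seen from their endpoints -/

/-- The edge `e`, seen from its initial vertex. -/
def srcInc (e : G.edgeSet) : Inc G (M.src e) :=
  ⟨e, by rw [← M.src_tgt e]; exact Sym2.mem_mk_left _ _⟩

/-- The edge `e`, seen from its terminal vertex. -/
def tgtInc (e : G.edgeSet) : Inc G (M.tgt e) :=
  ⟨e, by rw [← M.src_tgt e]; exact Sym2.mem_mk_right _ _⟩

theorem src_ne_tgt (e : G.edgeSet) : M.src e ≠ M.tgt e := by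
  have h : s(M.src e, M.tgt e) ∈ G.edgeSet := by rw [M.src_tgt]; exact e.2
  exact G.ne_of_adj (G.mem_edgeSet.1 h)

/-- Eliminator that replaces an arbitrary incident pair by one of two canonical ones, so that no
casts along equalities of vertices occur. -/
theorem inc_cases {motive : ∀ v, Inc G v → Prop} (hs : ∀ e, motive (M.src e) (M.srcInc e))
    (ht : ∀ e, motive (M.tgt e) (M.tgtInc e)) (v : V) (i : Inc G v) : motive v i := by
  obtain ⟨e, he⟩ := i
  have h := he
  rw [← M.src_tgt e, Sym2.mem_iff] at h
  rcases h with rfl | rfl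
  · exact hs e
  · exact ht e

theorem eq_srcInc {X : Type*} (a : ∀ v, Inc G v → X) (e : G.edgeSet) (v : V) (i : Inc G v)
    (hv : v = M.src e) (hi : i.1 = e) : a v i = a (M.src e) (M.srcInc e) := by
  subst hv; congr 1; exact Subtype.ext hi

theorem eq_tgtInc {X : Type*} (a : ∀ v, Inc G v → X) (e : G.edgeSet) (v : V) (i : Inc G v)
    (hv : v = M.tgt e) (hi : i.1 = e) : a v i = a (M.tgt e) (M.tgtInc e) := by
  subst hv; congr 1; exact Subtype.ext hi

theorem opp_srcInc (e : G.edgeSet) : opp (M.srcInc e) = M.tgt e := by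
  have h : s(M.src e, opp (M.srcInc e)) = s(M.src e, M.tgt e) :=
    (Sym2.other_spec (M.srcInc e).2).trans (M.src_tgt e).symm
  exact Sym2.congr_right.1 h

theorem opp_tgtInc (e : G.edgeSet) : opp (M.tgtInc e) = M.src e := by
  have h : s(M.tgt e, opp (M.tgtInc e)) = s(M.tgt e, M.src e) :=
    (Sym2.other_spec (M.tgtInc e).2).trans ((M.src_tgt e).symm.trans Sym2.eq_swap)
  exact Sym2.congr_right.1 h

theorem apply_oppInc_srcInc {X : Type*} (a : ∀ v, Inc G v → X) (e : G.edgeSet) :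
    a (opp (M.srcInc e)) (oppInc (M.srcInc e)) = a (M.tgt e) (M.tgtInc e) :=
  M.eq_tgtInc a e _ _ (M.opp_srcInc e) rfl

theorem apply_oppInc_tgtInc {X : Type*} (a : ∀ v, Inc G v → X) (e : G.edgeSet) :
    a (opp (M.tgtInc e)) (oppInc (M.tgtInc e)) = a (M.src e) (M.srcInc e) :=
  M.eq_srcInc a e _ _ (M.opp_tgtInc e) rfl

/-- Every edge has two endpoints. -/
def incEmbedding (p : Σ v, Inc G v) : G.edgeSet × Prop := (p.2.1, p.1 = M.src p.2.1)

/-- `Prop` plays the role of a two-element type: an incident pair is determined by its edge and by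
whether the vertex is the initial one. -/
theorem incEmbedding_injective : Function.Injective M.incEmbedding := by
  rintro ⟨v, i⟩ ⟨w, j⟩ h
  simp only [incEmbedding, Prod.mk.injEq] at h
  obtain ⟨h1, h2⟩ := h
  have hvw : v = w := by
    revert h1 h2
    induction v, i using M.inc_cases with
    | hs e =>
      intro h1 h2
      have h3 := h2.mp rfl
      rw [h3, ← h1]; rfl
    | ht e =>
      induction w, j using M.inc_cases with
      | hs e' =>
        intro h1 h2
        have h3 := h2.mpr rfl
        exact absurd h3.symm (M.src_ne_tgt e)
      | ht e' =>
        intro h1 _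
        have : e = e' := h1
        rw [this]
  subst hvw
  congr 1
  exact Subtype.ext h1

/-- The normalised distance to the vertex `v` along an incident edge. -/
def relDist (v : V) (i : Inc G v) (x : ℝ) : ℝ :=
  open Classical in if v = M.src i.1 then x / M.len i.1 else 1 - x / M.len i.1

theorem relDist_srcInc (e : G.edgeSet) (x : ℝ) :
    M.relDist (M.src e) (M.srcInc e) x = x / M.len e := if_pos rfl

theorem relDist_tgtInc (e : G.edgeSet) (x : ℝ) :
    M.relDist (M.tgt e) (M.tgtInc e) x = 1 - x / M.len e := if_neg (M.src_ne_tgt e).symm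

theorem continuous_relDist (v : V) (i : Inc G v) : Continuous (M.relDist v i) := by
  unfold relDist; split_ifs <;> fun_prop

theorem relDist_mem (v : V) (i : Inc G v) {x : ℝ} (hx : x ∈ Icc 0 (M.len i.1)) :
    M.relDist v i x ∈ Icc (0 : ℝ) 1 := by
  have h := M.len_pos i.1
  have h0 : 0 ≤ x / M.len i.1 := div_nonneg hx.1 h.le
  have h1 : x / M.len i.1 ≤ 1 := (div_le_one h).2 hx.2
  unfold relDist
  split_ifs
  · exact ⟨h0, h1⟩
  · exact ⟨by linarith, by linarith⟩

/-! ### The boundary maps as bounded operators -/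

theorem continuous_valueKernel (v : V) (i : Inc G v) :
    Continuous fun x => 4 - 6 * M.relDist v i x := by
  have := M.continuous_relDist v i; fun_prop

theorem continuous_cubicKernel (v : V) (i : Inc G v) :
    Continuous fun x => M.relDist v i x * (1 - M.relDist v i x) ^ 2 := by
  have := M.continuous_relDist v i; fun_prop

theorem continuous_derivKernel (v : V) (i : Inc G v) :
    Continuous fun x => 1 - M.relDist v i x := by
  have := M.continuous_relDist v i; fun_prop

/-- The coordinate `(v, e)` of the first boundary map, as a functional of `(f_e, -f_e'')`. -/
def valueFunctional (v : V) (i : Inc G v) :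
    L2Interval (M.len i.1) × L2Interval (M.len i.1) →ₗ[ℂ] ℂ :=
  ((√(M.len i.1) : ℝ) : ℂ) • (((M.len i.1 : ℝ) : ℂ)⁻¹ •
    (pairing (M.continuous_valueKernel v i) ∘ₗ LinearMap.fst ℂ _ _) -
      ((M.len i.1 : ℝ) : ℂ) • (pairing (M.continuous_cubicKernel v i) ∘ₗ LinearMap.snd ℂ _ _))

/-- The coordinate `(v, e)` of the second boundary map, as a functional of `(f_e, -f_e'')`. -/
def derivFunctional (v : V) (i : Inc G v) :
    L2Interval (M.len i.1) × L2Interval (M.len i.1) →ₗ[ℂ] ℂ :=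
  ((√(M.len i.1) : ℝ) : ℂ)⁻¹ • (pairing (M.continuous_derivKernel v i) ∘ₗ LinearMap.snd ℂ _ _)

theorem continuous_valueFunctional (v : V) (i : Inc G v) :
    Continuous (M.valueFunctional v i) := by
  have h := (M.len_pos i.1).le
  exact ((((continuous_pairing h (M.continuous_valueKernel v i)).comp continuous_fst).const_smul
    _).sub (((continuous_pairing h (M.continuous_cubicKernel v i)).comp
      continuous_snd).const_smul _)).const_smul _

theorem continuous_derivFunctional (v : V) (i : Inc G v) :
    Continuous (M.derivFunctional v i) :=
  ((continuous_pairing (M.len_pos i.1).le (M.continuous_derivKernel v i)).comp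
    continuous_snd).const_smul _

/-- The kernels are bounded by `4` and `1`, and Cauchy–Schwarz contributes a factor `√ℓ`. Together
with the prefactor `√ℓ` this cancels `ℓ⁻¹` in the first term and gives `ℓ²` in the second. -/
theorem norm_valueFunctional_le (v : V) (i : Inc G v)
    (p : L2Interval (M.len i.1) × L2Interval (M.len i.1)) :
    ‖M.valueFunctional v i p‖ ≤ 4 * ‖p.1‖ + M.len i.1 ^ 2 * ‖p.2‖ := by
  have hpos := M.len_pos i.1
  have hss := Real.mul_self_sqrt hpos.le
  have h1 := norm_pairing_le hpos.le (M.continuous_valueKernel v i) (C := 4) (fun x hx => by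
    have := M.relDist_mem v i hx
    exact abs_le.2 ⟨by linarith [this.2], by linarith [this.1]⟩) p.1
  have h2 := norm_pairing_le hpos.le (M.continuous_cubicKernel v i) (C := 1) (fun x hx => by
    obtain ⟨h0, h1⟩ := M.relDist_mem v i hx
    rw [abs_of_nonneg (by positivity)]
    exact mul_le_one₀ h1 (by positivity) (by nlinarith)) p.2
  calc ‖M.valueFunctional v i p‖ ≤ √(M.len i.1) * ((M.len i.1)⁻¹ * (4 * (√(M.len i.1) * ‖p.1‖)) + M.len i.1 * (1 * (√(M.len i.1) * ‖p.2‖))) := by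
        change ‖((√(M.len i.1) : ℝ) : ℂ) * (((M.len i.1 : ℝ) : ℂ)⁻¹ * _ - ((M.len i.1 : ℝ) : ℂ) * _)‖ ≤ _
        rw [norm_mul, Complex.norm_real, Real.norm_eq_abs, abs_of_nonneg (Real.sqrt_nonneg _)]
        gcongr
        refine (norm_sub_le _ _).trans (add_le_add ?_ ?_)
        · rw [norm_mul, norm_inv, Complex.norm_real, Real.norm_eq_abs, abs_of_pos hpos]
          gcongr
          exact h1
        · rw [norm_mul, Complex.norm_real, Real.norm_eq_abs, abs_of_pos hpos]
          gcongr
          exact h2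
    _ = (√(M.len i.1) * √(M.len i.1)) * (M.len i.1)⁻¹ * 4 * ‖p.1‖ + (√(M.len i.1) * √(M.len i.1)) * M.len i.1 * ‖p.2‖ := by ring
    _ = _ := by rw [hss, mul_inv_cancel₀ hpos.ne']; ring

theorem norm_derivFunctional_le (v : V) (i : Inc G v)
    (p : L2Interval (M.len i.1) × L2Interval (M.len i.1)) :
    ‖M.derivFunctional v i p‖ ≤ ‖p.2‖ := by
  have hpos := M.len_pos i.1
  have hs : 0 < √(M.len i.1) := Real.sqrt_pos.2 hpos
  have h2 := norm_pairing_le hpos.le (M.continuous_derivKernel v i) (C := 1) (fun x hx => by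
    obtain ⟨h0, h1⟩ := M.relDist_mem v i hx
    exact abs_le.2 ⟨by linarith, by linarith⟩) p.2
  change ‖((√(M.len i.1) : ℝ) : ℂ)⁻¹ * _‖ ≤ _
  rw [norm_mul, norm_inv, Complex.norm_real, Real.norm_eq_abs, abs_of_pos hs, inv_mul_le_iff₀ hs]
  simpa using h2

theorem _root_.QuantumGraph.integral_smul_neg {ℓ : ℝ} (k : ℝ → ℝ) (h : L2Interval ℓ) :
    ∫ x in Ioo 0 ℓ, k x • (-h : L2Interval ℓ) x = -∫ x in Ioo 0 ℓ, k x • h x := by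
  rw [← neg_one_smul ℂ h, integral_smul_smul, neg_one_mul]

/-! ### Identification of the integral functionals with boundary values. -/

section Green

variable {M} {e : G.edgeSet} {f h : L2Interval (M.len e)} {F D : ℝ → ℂ}

theorem hasDerivAt_div_len (x : ℝ) :
    HasDerivAt (fun x => x / M.len e) (M.len e)⁻¹ x := by
  simpa using (hasDerivAt_id x).div_const (M.len e)

theorem valueFunctional_srcInc_apply (f h : L2Interval (M.len e)) :
    M.valueFunctional (M.src e) (M.srcInc e) (f, h) = ((√(M.len e) : ℝ) : ℂ) *
      (((M.len e : ℝ) : ℂ)⁻¹ * (∫ x in Ioo 0 (M.len e), (4 - 6 * (x / M.len e)) • f x) -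
        ((M.len e : ℝ) : ℂ) *
          ∫ x in Ioo 0 (M.len e), (x / M.len e * (1 - x / M.len e) ^ 2) • h x) := by
  simp only [← M.relDist_srcInc e]; rfl

theorem valueFunctional_tgtInc_apply (f h : L2Interval (M.len e)) :
    M.valueFunctional (M.tgt e) (M.tgtInc e) (f, h) = ((√(M.len e) : ℝ) : ℂ) *
      (((M.len e : ℝ) : ℂ)⁻¹ * (∫ x in Ioo 0 (M.len e), (4 - 6 * (1 - x / M.len e)) • f x) -
        ((M.len e : ℝ) : ℂ) * ∫ x in Ioo 0 (M.len e),
          ((1 - x / M.len e) * (1 - (1 - x / M.len e)) ^ 2) • h x) := by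
  simp only [← M.relDist_tgtInc e]; rfl

theorem derivFunctional_srcInc_apply (f h : L2Interval (M.len e)) :
    M.derivFunctional (M.src e) (M.srcInc e) (f, h) = ((√(M.len e) : ℝ) : ℂ)⁻¹ *
      ∫ x in Ioo 0 (M.len e), (1 - x / M.len e) • h x := by
  simp only [← M.relDist_srcInc e]; rfl

theorem derivFunctional_tgtInc_apply (f h : L2Interval (M.len e)) :
    M.derivFunctional (M.tgt e) (M.tgtInc e) (f, h) = ((√(M.len e) : ℝ) : ℂ)⁻¹ *
      ∫ x in Ioo 0 (M.len e), (1 - (1 - x / M.len e)) • h x := by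
  simp only [← M.relDist_tgtInc e]; rfl

theorem valueFunctional_srcInc (hFD : IsPrimitivePair f (-h) F D) :
    M.valueFunctional (M.src e) (M.srcInc e) (f, h) = ((√(M.len e) : ℝ) : ℂ) * F 0 := by
  have hpos := M.len_pos e
  have hne : ((M.len e : ℝ) : ℂ) ≠ 0 := by exact_mod_cast hpos.ne'
  have := hFD.green_value hpos.le (t := fun x => x / M.len e) hasDerivAt_div_len (by simp)
    (by simp [hpos.ne'])
  rw [integral_smul_neg] at this
  rw [valueFunctional_srcInc_apply]
  generalize (∫ x in Ioo 0 (M.len e), (4 - 6 * (x / M.len e)) • f x) = A at this ⊢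
  generalize (∫ x in Ioo 0 (M.len e), (x / M.len e * (1 - x / M.len e) ^ 2) • h x) = B at this ⊢
  congr 1
  -- Here `s = 1/ℓ`; multiplying by `ℓ` turns the boundary term `s F(0)` into `F(0)` and `s²` into
  -- `ℓ⁻¹`.
  have h3 := congrArg (fun z => ((M.len e : ℝ) : ℂ) * z) this
  simp only [zero_div, div_self hpos.ne', sub_self, mul_zero, zero_smul, sub_zero, mul_one,
    Complex.real_smul, Complex.ofReal_pow, Complex.ofReal_inv] at h3
  rw [mul_inv_cancel_left₀ hne] at h3
  rw [← h3]
  field_simp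
  ring

theorem valueFunctional_tgtInc (hFD : IsPrimitivePair f (-h) F D) :
    M.valueFunctional (M.tgt e) (M.tgtInc e) (f, h) = ((√(M.len e) : ℝ) : ℂ) * F (M.len e) := by
  have hpos := M.len_pos e
  have hne : ((M.len e : ℝ) : ℂ) ≠ 0 := by exact_mod_cast hpos.ne'
  -- Measuring distance from the terminal vertex makes `s = -1/ℓ`, which compensates for the sign of
  -- the boundary term at `ℓ`.
  have := hFD.green_value hpos.le (t := fun x => 1 - x / M.len e)
    (fun x => (hasDerivAt_div_len x).const_sub 1) (by simp) (by simp [hpos.ne'])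
  rw [integral_smul_neg] at this
  rw [valueFunctional_tgtInc_apply]
  generalize (∫ x in Ioo 0 (M.len e), (4 - 6 * (1 - x / M.len e)) • f x) = A at this ⊢
  generalize (∫ x in Ioo 0 (M.len e), ((1 - x / M.len e) * (1 - (1 - x / M.len e)) ^ 2) • h x) = B at this ⊢
  congr 1
  have h3 := congrArg (fun z => ((M.len e : ℝ) : ℂ) * z) this
  simp only [zero_div, div_self hpos.ne', sub_self, mul_zero, zero_smul, sub_zero, mul_one,
    Complex.real_smul, Complex.ofReal_pow, Complex.ofReal_inv, Complex.ofReal_neg, zero_sub,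
    neg_mul, neg_neg] at h3
  rw [mul_inv_cancel_left₀ hne] at h3
  rw [← h3]
  field_simp
  ring

theorem derivFunctional_srcInc (hFD : IsPrimitivePair f (-h) F D) :
    M.derivFunctional (M.src e) (M.srcInc e) (f, h) = ((√(M.len e) : ℝ) : ℂ)⁻¹ *
      (D 0 + ((M.len e : ℝ) : ℂ)⁻¹ * (F 0 - F (M.len e))) := by
  have hpos := M.len_pos e
  have := hFD.green_deriv hpos.le (t := fun x => x / M.len e) hasDerivAt_div_len
  rw [integral_smul_neg, neg_eq_iff_eq_neg] at this
  rw [derivFunctional_srcInc_apply]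
  rw [this]
  simp only [zero_div, div_self hpos.ne', sub_self, zero_smul, sub_zero, one_smul,
    Complex.real_smul, Complex.ofReal_inv]
  ring

theorem derivFunctional_tgtInc (hFD : IsPrimitivePair f (-h) F D) :
    M.derivFunctional (M.tgt e) (M.tgtInc e) (f, h) = ((√(M.len e) : ℝ) : ℂ)⁻¹ *
      (-D (M.len e) + ((M.len e : ℝ) : ℂ)⁻¹ * (F (M.len e) - F 0)) := by
  have hpos := M.len_pos e
  have := hFD.green_deriv hpos.le (t := fun x => 1 - x / M.len e)
    (fun x => (hasDerivAt_div_len x).const_sub 1)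
  rw [integral_smul_neg, neg_eq_iff_eq_neg] at this
  rw [derivFunctional_tgtInc_apply]
  rw [this]
  simp only [zero_div, div_self hpos.ne', sub_self, zero_smul, sub_zero, one_smul,
    Complex.real_smul, Complex.ofReal_inv, Complex.ofReal_neg]
  ring

end Green

end MetricGraph

namespace MetricGraph

variable {V : Type*} {G : SimpleGraph V} (M : MetricGraph G)

/-! ### Boundary values of functions in the maximal domain -/

/-- Two continuous representatives that agree almost everywhere on an open interval agree everywhere
there, so they have the same one-sided limits. -/
theorem HasVertexData.unique {M : MetricGraph G} {f : M.L2} {v : V} {i : Inc G v} {c d c' d' : ℂ}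
    (h : M.HasVertexData f v i c d) (h' : M.HasVertexData f v i c' d') : c = c' ∧ d = d' := by
  obtain ⟨F, hF, hae, h0, h1⟩ := h
  obtain ⟨F', hF', hae', h0', h1'⟩ := h'
  have hpos := M.len_pos i.1
  have heq : EqOn F F' (Ioo 0 (M.len i.1)) :=
    Measure.eqOn_open_of_ae_eq (hae.trans hae'.symm) isOpen_Ioo hF hF'
  have hv : v = M.src i.1 ∨ v = M.tgt i.1 := by
    induction v, i using M.inc_cases with
    | hs e => exact Or.inl rfl
    | ht e => exact Or.inr rfl
  rcases hv with hv | hv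
  · have hev : F =ᶠ[𝓝[>] 0] F' := by
      filter_upwards [Ioo_mem_nhdsGT hpos] with x hx using heq hx
    have hc : c = c' := tendsto_nhds_unique ((h0 hv).1.congr' hev) (h0' hv).1
    subst hc
    refine ⟨rfl, tendsto_nhds_unique ((h0 hv).2.congr' ?_) (h0' hv).2⟩
    filter_upwards [hev] with x hx
    rw [hx]
  · have hev : F =ᶠ[𝓝[<] M.len i.1] F' := by
      filter_upwards [Ioo_mem_nhdsLT hpos] with x hx using heq hx
    have hc : c = c' := tendsto_nhds_unique ((h1 hv).1.congr' hev) (h1' hv).1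
    subst hc
    refine ⟨rfl, tendsto_nhds_unique ((h1 hv).2.congr' ?_) (h1' hv).2⟩
    filter_upwards [hev] with x hx
    rw [hx]

section Data

variable {M} {e : G.edgeSet} {f : M.L2} {h : L2Interval (M.len e)} {F D : ℝ → ℂ}

theorem hasVertexData_srcInc (hFD : IsPrimitivePair (f e) h F D) :
    M.HasVertexData f (M.src e) (M.srcInc e) (F 0) (D 0) := by
  refine ⟨F, hFD.continuous_fst.continuousOn, hFD.ae_eq, fun _ => ⟨?_, ?_⟩,
    fun h => absurd h (M.src_ne_tgt e)⟩
  · exact hFD.continuous_fst.continuousAt.continuousWithinAt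
  · have := (hFD.hasDerivAt 0).tendsto_slope.mono_left (nhdsWithin_mono 0 (s := Ioi 0)
      fun x hx => ne_of_gt hx)
    refine this.congr fun x => ?_
    rw [slope_def_module, sub_zero, Complex.real_smul, Complex.ofReal_inv, div_eq_inv_mul]

theorem hasVertexData_tgtInc (hFD : IsPrimitivePair (f e) h F D) :
    M.HasVertexData f (M.tgt e) (M.tgtInc e) (F (M.len e)) (-D (M.len e)) := by
  refine ⟨F, hFD.continuous_fst.continuousOn, hFD.ae_eq,
    fun h => absurd h (M.src_ne_tgt e).symm, fun _ => ⟨?_, ?_⟩⟩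
  · exact hFD.continuous_fst.continuousAt.continuousWithinAt
  · have := ((hFD.hasDerivAt (M.len e)).tendsto_slope.mono_left (nhdsWithin_mono _
      (s := Iio (M.len e)) fun x hx => ne_of_lt hx)).neg
    refine this.congr fun x => ?_
    rw [slope_def_module, Complex.real_smul, Complex.ofReal_inv, div_eq_inv_mul, ← neg_mul,
      ← inv_neg, ← Complex.ofReal_neg, neg_sub]
    rfl

end Data

theorem exists_isPrimitivePair {w : M.L2 × M.L2} (hw : w ∈ M.maxGraph) (e : G.edgeSet) :
    ∃ F D, IsPrimitivePair (w.1 e) (-(w.2 e)) F D :=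
  (HasSecondDeriv.hasVeryWeakDeriv (hw e)).exists_isPrimitivePair (M.len_pos e)

/-- The boundary value `f_e(v)`, as a functional of `(f, -f'')`. -/
def endValue (w : M.L2 × M.L2) (v : V) (i : Inc G v) : ℂ :=
  ((√(M.len i.1) : ℝ) : ℂ)⁻¹ * M.valueFunctional v i (w.1 i.1, w.2 i.1)

/-- The inward derivative `f_e'(v)`, as a functional of `(f, -f'')`. -/
def endDeriv (w : M.L2 × M.L2) (v : V) (i : Inc G v) : ℂ :=
  ((√(M.len i.1) : ℝ) : ℂ) * M.derivFunctional v i (w.1 i.1, w.2 i.1) -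
    ((M.len i.1 : ℝ) : ℂ)⁻¹ * (M.endValue w v i - M.endValue w (opp i) (oppInc i))

theorem sqrt_len_ne_zero (e : G.edgeSet) : ((√(M.len e) : ℝ) : ℂ) ≠ 0 :=
  Complex.ofReal_ne_zero.2 (Real.sqrt_pos.2 (M.len_pos e)).ne'

theorem len_ne_zero (e : G.edgeSet) : ((M.len e : ℝ) : ℂ) ≠ 0 :=
  Complex.ofReal_ne_zero.2 (M.len_pos e).ne'

theorem sqrt_len_mul_self (e : G.edgeSet) :
    ((√(M.len e) : ℝ) : ℂ) * ((√(M.len e) : ℝ) : ℂ) = ((M.len e : ℝ) : ℂ) := by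
  rw [← Complex.ofReal_mul, Real.mul_self_sqrt (M.len_pos e).le]

/-- Bridge between the limits that define boundary values and the integral functionals: both are
read off from the `C¹` representative on the edge. -/
theorem hasVertexData_of_mem_maxGraph {w : M.L2 × M.L2} (hw : w ∈ M.maxGraph) (v : V)
    (i : Inc G v) : M.HasVertexData w.1 v i (M.endValue w v i) (M.endDeriv w v i) := by
  have hsrc : ∀ e F D, IsPrimitivePair (w.1 e) (-(w.2 e)) F D →
      M.endValue w (M.src e) (M.srcInc e) = F 0 := fun e F D h =>
    (congrArg _ (valueFunctional_srcInc h)).trans (inv_mul_cancel_left₀ (M.sqrt_len_ne_zero e) _)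
  have htgt : ∀ e F D, IsPrimitivePair (w.1 e) (-(w.2 e)) F D →
      M.endValue w (M.tgt e) (M.tgtInc e) = F (M.len e) := fun e F D h =>
    (congrArg _ (valueFunctional_tgtInc h)).trans (inv_mul_cancel_left₀ (M.sqrt_len_ne_zero e) _)
  induction v, i using M.inc_cases with
  | hs e =>
    obtain ⟨F, D, hFD⟩ := M.exists_isPrimitivePair hw e
    have h1 : M.endDeriv w (M.src e) (M.srcInc e) = D 0 := by
      rw [endDeriv, M.apply_oppInc_srcInc (M.endValue w), hsrc e F D hFD, htgt e F D hFD]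
      refine (congrArg₂ _ (congrArg _ (derivFunctional_srcInc hFD)) rfl).trans ?_
      exact (congrArg (· - _) (mul_inv_cancel_left₀ (M.sqrt_len_ne_zero e) _)).trans
        (add_sub_cancel_right _ _)
    rw [h1, hsrc e F D hFD]
    exact hasVertexData_srcInc hFD
  | ht e =>
    obtain ⟨F, D, hFD⟩ := M.exists_isPrimitivePair hw e
    have h1 : M.endDeriv w (M.tgt e) (M.tgtInc e) = -D (M.len e) := by
      rw [endDeriv, M.apply_oppInc_tgtInc (M.endValue w), hsrc e F D hFD, htgt e F D hFD]
      refine (congrArg₂ _ (congrArg _ (derivFunctional_tgtInc hFD)) rfl).trans ?_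
      exact (congrArg (· - _) (mul_inv_cancel_left₀ (M.sqrt_len_ne_zero e) _)).trans
        (add_sub_cancel_right _ _)
    rw [h1, htgt e F D hFD]
    exact hasVertexData_tgtInc hFD

theorem isClosed_maxGraph : IsClosed (M.maxGraph : Set (M.L2 × M.L2)) := by
  have : (M.maxGraph : Set (M.L2 × M.L2)) = ⋂ e, (fun w : M.L2 × M.L2 => (w.1 e, -(w.2 e))) ⁻¹'
      {p : L2Interval (M.len e) × L2Interval (M.len e) | HasSecondDeriv p.1 p.2} := by
    ext w
    simp only [mem_iInter, mem_preimage, mem_ofPred_eq]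
    rfl
  rw [this]
  exact isClosed_iInter fun e => (isClosed_hasSecondDeriv (M.len_pos e)).preimage
    (((continuous_lp_apply e).comp continuous_fst).prodMk
      ((continuous_lp_apply e).comp continuous_snd).neg)

/-! ### The boundary maps and their right inverse -/

/-- Restriction of a pair of functions on the graph to an edge. -/
def restrictEdge (e : G.edgeSet) :
    M.L2 × M.L2 →ₗ[ℂ] L2Interval (M.len e) × L2Interval (M.len e) where
  toFun w := (w.1 e, w.2 e)
  map_add' _ _ := rfl
  map_smul' _ _ := rfl

theorem continuous_restrictEdge (e : G.edgeSet) : Continuous (M.restrictEdge e) :=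
  ((continuous_lp_apply e).comp continuous_fst).prodMk
    ((continuous_lp_apply e).comp continuous_snd)

/-- The family of vectors with coordinates `φ v i` applied to the restriction to the edge. -/
def bdryComponents (φ : ∀ v (i : Inc G v),
    L2Interval (M.len i.1) × L2Interval (M.len i.1) →ₗ[ℂ] ℂ) :
    M.L2 × M.L2 →ₗ[ℂ] ∀ v, EuclideanSpace ℂ (Inc G v) where
  toFun w v := WithLp.toLp 2 fun i => φ v i (M.restrictEdge i.1 w)
  map_add' w w' := by
    funext v; ext i; simp
  map_smul' c w := by
    funext v; ext i; simp

theorem continuous_bdryComponents {φ : ∀ v (i : Inc G v),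
    L2Interval (M.len i.1) × L2Interval (M.len i.1) →ₗ[ℂ] ℂ} (hφ : ∀ v i, Continuous (φ v i))
    (v : V) : Continuous fun w => M.bdryComponents φ w v := by
  refine (PiLp.continuous_toLp 2 _).comp (continuous_pi fun i => ?_)
  exact (hφ v i).comp (M.continuous_restrictEdge i.1)

/-! ### Square summability over incident pairs and boundedness of the boundary maps. -/

variable [∀ v, Fintype (Inc G v)]

theorem memℓp_bdry (M : MetricGraph G) {x : ∀ v, EuclideanSpace ℂ (Inc G v)} {g : G.edgeSet → ℝ} (hg : Summable g)
    (h : ∀ v (i : Inc G v), ‖x v i‖ ^ 2 ≤ g i.1) : Memℓp x 2 := by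
  have hg0 : ∀ e, 0 ≤ g e := fun e => (sq_nonneg _).trans (h (M.src e) (M.srcInc e))
  have h1 : Summable fun p : G.edgeSet × Prop => g p.1 :=
    (summable_prod_of_nonneg fun p => hg0 p.1).2
      -- The factor `2` counts the two endpoints of an edge.
      ⟨fun e => (hasSum_fintype _).summable, by simpa using hg.mul_left 2⟩
  have h2 : Summable fun p : Σ v, Inc G v => ‖x p.1 p.2‖ ^ 2 :=
    (h1.comp_injective M.incEmbedding_injective).of_nonneg_of_le (fun p => sq_nonneg _)
      fun p => h p.1 p.2
  rw [memℓp_two_iff]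
  refine h2.sigma.congr fun v => ?_
  rw [EuclideanSpace.norm_sq_eq, tsum_fintype]

theorem summable_bdry (x : BdrySpace G) :
    Summable fun p : Σ v, Inc G v => ‖x p.1 p.2‖ ^ 2 := by
  refine (summable_sigma_of_nonneg fun p => sq_nonneg _).2
    ⟨fun v => (hasSum_fintype _).summable, ?_⟩
  refine (summable_norm_sq x).congr fun v => ?_
  rw [EuclideanSpace.norm_sq_eq, tsum_fintype]

theorem summable_bdry_srcInc (x : BdrySpace G) :
    Summable fun e => ‖x (M.src e) (M.srcInc e)‖ ^ 2 :=
  (summable_bdry x).comp_injective (i := fun e => (⟨M.src e, M.srcInc e⟩ : Σ v, Inc G v))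
    fun _ _ h => congrArg (fun p : Σ v, Inc G v => p.2.1) h

theorem summable_bdry_tgtInc (x : BdrySpace G) :
    Summable fun e => ‖x (M.tgt e) (M.tgtInc e)‖ ^ 2 :=
  (summable_bdry x).comp_injective (i := fun e => (⟨M.tgt e, M.tgtInc e⟩ : Σ v, Inc G v))
    fun _ _ h => congrArg (fun p : Σ v, Inc G v => p.2.1) h

theorem continuous_bdry_apply (v : V) (i : Inc G v) : Continuous fun x : BdrySpace G => x v i :=
  (EuclideanSpace.proj (𝕜 := ℂ) i).continuous.comp (continuous_lp_apply v)

theorem bdry_ext {x y : BdrySpace G} (h : ∀ v i, x v i = y v i) : x = y :=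
  lp.ext (funext fun v => PiLp.ext (h v))

variable {M} {K : ℝ} (hK : ∀ e, M.len e ≤ K)

/-- The first boundary map, extended to a bounded operator on all pairs `(f, h)`. -/
def bdryMap0 : M.L2 × M.L2 →L[ℂ] BdrySpace G :=
  lpOfComponents (M.bdryComponents M.valueFunctional) (fun w => by
    -- The constants come from `(x + y)² ≤ 2x² + 2y²` with `x = 4‖f_e‖` and `y = K²‖h_e‖`.
    refine M.memℓp_bdry (((summable_norm_sq w.1).mul_left 32).add
      ((summable_norm_sq w.2).mul_left (2 * (K ^ 2) ^ 2))) fun v i => ?_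
    have h1 := M.norm_valueFunctional_le v i (M.restrictEdge i.1 w)
    have h2 : M.len i.1 ^ 2 ≤ K ^ 2 := pow_le_pow_left₀ (M.len_pos _).le (hK _) 2
    have h3 : ‖M.valueFunctional v i (M.restrictEdge i.1 w)‖ ≤
        4 * ‖w.1 i.1‖ + K ^ 2 * ‖w.2 i.1‖ :=
      h1.trans (add_le_add le_rfl (mul_le_mul_of_nonneg_right h2 (norm_nonneg _)))
    refine (pow_le_pow_left₀ (norm_nonneg _) h3 2).trans ?_
    nlinarith [sq_nonneg (4 * ‖w.1 i.1‖ - K ^ 2 * ‖w.2 i.1‖)])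
    (M.continuous_bdryComponents M.continuous_valueFunctional)

variable (M) in
/-- The second boundary map, extended to a bounded operator on all pairs `(f, h)`. -/
def bdryMap1 : M.L2 × M.L2 →L[ℂ] BdrySpace G :=
  lpOfComponents (M.bdryComponents M.derivFunctional) (fun w =>
    M.memℓp_bdry (summable_norm_sq w.2) fun v i =>
      pow_le_pow_left₀ (norm_nonneg _) (M.norm_derivFunctional_le v i (M.restrictEdge i.1 w)) 2)
    (M.continuous_bdryComponents M.continuous_derivFunctional)

/-- Both boundary maps. -/
def bdryMap : M.L2 × M.L2 →L[ℂ] BdrySpace G × BdrySpace G :=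
  (bdryMap0 hK).prod M.bdryMap1

theorem bdryMap_fst_apply (w : M.L2 × M.L2) (v : V) (i : Inc G v) :
    (bdryMap hK w).1 v i = M.valueFunctional v i (w.1 i.1, w.2 i.1) := rfl

theorem bdryMap_snd_apply (w : M.L2 × M.L2) (v : V) (i : Inc G v) :
    (bdryMap hK w).2 v i = M.derivFunctional v i (w.1 i.1, w.2 i.1) := rfl

theorem bdryMap_fst_eq_endValue (w : M.L2 × M.L2) (v : V) (i : Inc G v) :
    (bdryMap hK w).1 v i = ((√(M.len i.1) : ℝ) : ℂ) * M.endValue w v i := by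
  rw [endValue, mul_inv_cancel_left₀ (M.sqrt_len_ne_zero _), bdryMap_fst_apply]

theorem bdryMap_snd_eq_endDeriv (w : M.L2 × M.L2) (v : V) (i : Inc G v) :
    (bdryMap hK w).2 v i = ((√(M.len i.1) : ℝ) : ℂ)⁻¹ * M.endDeriv w v i +
      ((M.len i.1 * √(M.len i.1) : ℝ) : ℂ)⁻¹ *
        (M.endValue w v i - M.endValue w (opp i) (oppInc i)) := by
  have h1 := M.sqrt_len_ne_zero i.1
  have h2 := M.len_ne_zero i.1
  rw [endDeriv, mul_sub, inv_mul_cancel_left₀ h1, bdryMap_snd_apply, Complex.ofReal_mul, mul_inv]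
  ring

/-- Existence and uniqueness of boundary data at once: uniqueness of limits forces the values and
derivatives to be those given by the bounded functionals. -/
theorem isBoundaryData_iff {w : M.L2 × M.L2} (hw : w ∈ M.maxGraph) (x y : BdrySpace G) :
    M.IsBoundaryData w.1 x y ↔ (x, y) = bdryMap hK w := by
  have hd := M.hasVertexData_of_mem_maxGraph hw
  constructor
  · rintro ⟨a, b, hab, hxy⟩
    have ha : a = M.endValue w := funext fun v => funext fun i => ((hab v i).unique (hd v i)).1
    have hb : b = M.endDeriv w := funext fun v => funext fun i => ((hab v i).unique (hd v i)).2
    subst ha hb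
    refine Prod.ext (bdry_ext fun v i => ?_) (bdry_ext fun v i => ?_)
    · rw [bdryMap_fst_eq_endValue]; exact (hxy v i).1
    · rw [bdryMap_snd_eq_endDeriv]; exact (hxy v i).2
  · intro h
    obtain ⟨rfl, rfl⟩ := Prod.mk.inj h
    exact ⟨M.endValue w, M.endDeriv w, hd, fun v i =>
      ⟨bdryMap_fst_eq_endValue hK w v i, bdryMap_snd_eq_endDeriv hK w v i⟩⟩

/-! ### The bounded right inverse given by cubic functions on the edges. -/

variable (M) in
/-- The boundary data of a pair of vectors at the two endpoints of an edge. -/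
def edgeData (e : G.edgeSet) : BdrySpace G × BdrySpace G →ₗ[ℂ] (Fin 4 → ℂ) where
  toFun p := ![p.1 (M.src e) (M.srcInc e), p.1 (M.tgt e) (M.tgtInc e),
    p.2 (M.src e) (M.srcInc e), p.2 (M.tgt e) (M.tgtInc e)]
  map_add' p q := by ext j; fin_cases j <;> rfl
  map_smul' c p := by ext j; fin_cases j <;> rfl

theorem continuous_edgeData (e : G.edgeSet) : Continuous (M.edgeData e) := by
  refine continuous_pi fun j => ?_
  fin_cases j
  · exact (continuous_bdry_apply (M.src e) (M.srcInc e)).comp continuous_fst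
  · exact (continuous_bdry_apply (M.tgt e) (M.tgtInc e)).comp continuous_fst
  · exact (continuous_bdry_apply (M.src e) (M.srcInc e)).comp continuous_snd
  · exact (continuous_bdry_apply (M.tgt e) (M.tgtInc e)).comp continuous_snd

/-- The functions with given boundary data that are cubic on every edge. -/
def liftMap0 : BdrySpace G × BdrySpace G →L[ℂ] M.L2 :=
  lpOfComponents (LinearMap.pi fun e => edgeLift (M.len e) ∘ₗ M.edgeData e) (fun p => by
    rw [memℓp_two_iff]
    refine Summable.of_nonneg_of_le (fun _ => sq_nonneg _) (fun e => ?_)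
      (((((M.summable_bdry_srcInc p.1).add (M.summable_bdry_tgtInc p.1)).mul_left 4).add
        (((M.summable_bdry_srcInc p.2).add (M.summable_bdry_tgtInc p.2)).mul_left
          (4 * (K ^ 2) ^ 2))))
    have h1 := norm_edgeLift_le (M.len_pos e) (M.edgeData e p)
    have h2 : M.len e ^ 2 ≤ K ^ 2 := pow_le_pow_left₀ (M.len_pos _).le (hK _) 2
    have h3 : ‖edgeLift (M.len e) (M.edgeData e p)‖ ≤
        ‖p.1 (M.src e) (M.srcInc e)‖ + ‖p.1 (M.tgt e) (M.tgtInc e)‖ +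
          K ^ 2 * (‖p.2 (M.src e) (M.srcInc e)‖ + ‖p.2 (M.tgt e) (M.tgtInc e)‖) :=
      h1.trans (add_le_add le_rfl (mul_le_mul_of_nonneg_right h2 (by positivity)))
    refine (pow_le_pow_left₀ (norm_nonneg _) h3 2).trans ?_
    generalize ‖p.1 (M.src e) (M.srcInc e)‖ = a
    generalize ‖p.1 (M.tgt e) (M.tgtInc e)‖ = b
    generalize ‖p.2 (M.src e) (M.srcInc e)‖ = c
    generalize ‖p.2 (M.tgt e) (M.tgtInc e)‖ = d
    generalize K ^ 2 = k
    -- Two rounds of `(x + y)² ≤ 2x² + 2y²` produce the coefficients `4` and `4 (K²)²`.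
    have e1 : (a + b + k * (c + d)) ^ 2 ≤ 2 * (a + b) ^ 2 + 2 * (k ^ 2 * (c + d) ^ 2) := by
      nlinarith [sq_nonneg (a + b - k * (c + d))]
    have e2 : (c + d) ^ 2 ≤ 2 * (c ^ 2 + d ^ 2) := by nlinarith [sq_nonneg (c - d)]
    nlinarith [sq_nonneg (a - b), mul_le_mul_of_nonneg_left e2 (sq_nonneg k)])
    (fun e => ((edgeLift (M.len e)).continuous_of_finiteDimensional).comp (continuous_edgeData e))

variable (M) in
/-- The negative second derivatives of the functions `liftMap0`. -/
def liftMap1 : BdrySpace G × BdrySpace G →L[ℂ] M.L2 :=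
  lpOfComponents (LinearMap.pi fun e => edgeLiftImage (M.len e) ∘ₗ M.edgeData e) (fun p => by
    rw [memℓp_two_iff]
    refine Summable.of_nonneg_of_le (fun _ => sq_nonneg _) (fun e => ?_)
      (((M.summable_bdry_srcInc p.2).add (M.summable_bdry_tgtInc p.2)).mul_left 32)
    have h3 : ‖edgeLiftImage (M.len e) (M.edgeData e p)‖ ≤
        4 * (‖p.2 (M.src e) (M.srcInc e)‖ + ‖p.2 (M.tgt e) (M.tgtInc e)‖) :=
      norm_edgeLiftImage_le (M.len_pos e) (M.edgeData e p)
    refine (pow_le_pow_left₀ (norm_nonneg _) h3 2).trans ?_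
    nlinarith [sq_nonneg (‖p.2 (M.src e) (M.srcInc e)‖ - ‖p.2 (M.tgt e) (M.tgtInc e)‖)])
    (fun e => ((edgeLiftImage (M.len e)).continuous_of_finiteDimensional).comp
      (continuous_edgeData e))

/-- A bounded right inverse of the boundary maps with values in the graph of `H_max`. -/
def liftMap : BdrySpace G × BdrySpace G →L[ℂ] M.L2 × M.L2 := (liftMap0 hK).prod M.liftMap1

theorem isPrimitivePair_liftMap (p : BdrySpace G × BdrySpace G) (e : G.edgeSet) :
    IsPrimitivePair ((liftMap hK p).1 e) (-((liftMap hK p).2 e))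
      (liftFun (M.len e) (M.edgeData e p)) (liftDeriv (M.len e) (M.edgeData e p)) :=
  isPrimitivePair_lift (M.len_pos e) (M.edgeData e p)

theorem liftMap_mem_maxGraph (p : BdrySpace G × BdrySpace G) : liftMap hK p ∈ M.maxGraph :=
  fun e => (isPrimitivePair_liftMap hK p e).hasSecondDeriv (M.len_pos e)

/-- The affine part of the cubic carries the end values and is annihilated by the second boundary
map. The terms `t (1 - t)²` and `t² (1 - t)` vanish at both ends, and each has a nonzero derivative
at exactly one of them. -/
theorem bdryMap_liftMap (p : BdrySpace G × BdrySpace G) : bdryMap hK (liftMap hK p) = p := by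
  refine Prod.ext (bdry_ext fun v i => ?_) (bdry_ext fun v i => ?_)
  · rw [bdryMap_fst_apply]
    induction v, i using M.inc_cases with
    | hs e =>
      refine (valueFunctional_srcInc (isPrimitivePair_liftMap hK p e)).trans ?_
      have h1 := M.sqrt_len_ne_zero e
      simp [liftFun, edgeData, mul_inv_cancel_left₀ h1]
    | ht e =>
      refine (valueFunctional_tgtInc (isPrimitivePair_liftMap hK p e)).trans ?_
      have h1 := M.sqrt_len_ne_zero e
      simp [liftFun, edgeData, mul_inv_cancel_left₀ h1, M.len_ne_zero e]
  · rw [bdryMap_snd_apply]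
    induction v, i using M.inc_cases with
    | hs e =>
      refine (derivFunctional_srcInc (isPrimitivePair_liftMap hK p e)).trans ?_
      have h1 := M.sqrt_len_ne_zero e
      have h2 := M.len_ne_zero e
      have h3 := (pow_two _).trans (M.sqrt_len_mul_self e)
      simp only [liftFun, liftDeriv, edgeData, div_self (M.len_pos e).ne', zero_div]
      simp only [LinearMap.coe_mk, AddHom.coe_mk, Matrix.cons_val]
      field_simp
      simp only [h3, Complex.ofReal_zero, Complex.ofReal_one]
      ring
    | ht e =>
      refine (derivFunctional_tgtInc (isPrimitivePair_liftMap hK p e)).trans ?_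
      have h1 := M.sqrt_len_ne_zero e
      have h2 := M.len_ne_zero e
      have h3 := (pow_two _).trans (M.sqrt_len_mul_self e)
      simp only [liftFun, liftDeriv, edgeData, div_self (M.len_pos e).ne', zero_div]
      simp only [LinearMap.coe_mk, AddHom.coe_mk, Matrix.cons_val]
      field_simp
      simp only [h3, Complex.ofReal_zero, Complex.ofReal_one]
      ring

end MetricGraph

namespace MetricGraph

/-! ### The matrix form of the delta conditions -/

theorem Cmat_mulVec (n : ℕ) (a : ℝ) (u : Fin (n + 1) → ℂ) (i : Fin (n + 1)) :
    (Cmat (n + 1) a).mulVec u i =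
      if h : (i : ℕ) < n then u i - u ⟨i + 1, by omega⟩ else (a : ℂ) * u 0 := by
  rw [Matrix.mulVec, dotProduct]
  split_ifs with h
  · have h1 : ∀ j : Fin (n + 1), Cmat (n + 1) a i j * u j =
        (if j = i then u j else 0) - (if j = ⟨i + 1, by omega⟩ then u j else 0) := by
      intro j
      have h2 : (i : ℕ) + 1 < n + 1 := by omega
      simp only [Cmat, h2, if_true, Fin.ext_iff]
      split_ifs <;> first | omega | simp
    simp only [h1]
    rw [Finset.sum_sub_distrib]
    simp
  · have h1 : ∀ j : Fin (n + 1), Cmat (n + 1) a i j * u j = if j = 0 then (a : ℂ) * u j else 0 := by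
      intro j
      have h2 : ¬ (i : ℕ) + 1 < n + 1 := by omega
      simp only [Cmat, h2, if_false, Fin.ext_iff, Fin.val_zero, ite_mul, zero_mul]
    simp only [h1]
    simp

theorem Dmat_mulVec (n : ℕ) (w : Fin (n + 1) → ℂ) (i : Fin (n + 1)) :
    (Dmat (n + 1)).mulVec w i = if (i : ℕ) < n then 0 else ∑ j, w j := by
  rw [Matrix.mulVec, dotProduct]
  have : ((i : ℕ) + 1 = n + 1) ↔ ¬ (i : ℕ) < n := by omega
  simp only [Dmat, this]
  split_ifs <;> simp

/-- All rows but the last equate consecutive entries of `u`; the last row is the condition on the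
sum. -/
theorem Cmat_mulVec_eq_Dmat_mulVec_iff {d : ℕ} (hd : 1 ≤ d) (a : ℝ) (u w : Fin d → ℂ) :
    (Cmat d a).mulVec u = (Dmat d).mulVec w ↔
      ∃ c, (∀ i, u i = c) ∧ ∑ i, w i = (a : ℂ) * c := by
  obtain ⟨n, rfl⟩ : ∃ n, d = n + 1 := ⟨d - 1, by omega⟩
  simp only [funext_iff, Cmat_mulVec, Dmat_mulVec]
  constructor
  · intro h
    have hu : ∀ m (hm : m < n + 1), u ⟨m, hm⟩ = u 0 := by
      intro m
      induction m with
      | zero => intro _; rfl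
      | succ k ih =>
        intro hk
        have h1 := h ⟨k, by omega⟩
        have hkn : k < n := by omega
        simp only [hkn, dite_true, if_true] at h1
        rw [← sub_eq_zero.1 h1, ih]
    refine ⟨u 0, fun i => hu i i.2, ?_⟩
    have h1 := h (Fin.last n)
    simp only [Fin.val_last, lt_irrefl, dite_false, if_false] at h1
    exact h1.symm
  · rintro ⟨c, hc, hw⟩ i
    split_ifs
    · rw [hc, hc, sub_self]
    · rw [hc, hw]

variable {V : Type*} {G : SimpleGraph V} {M : MetricGraph G}

theorem snd_apply_eq_zero {w : M.L2 × M.L2} (hw : w ∈ M.maxGraph) {e : G.edgeSet}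
    (he : w.1 e = 0) : w.2 e = 0 := by
  obtain ⟨g, h1, h2⟩ := hw e
  rw [he] at h1
  rw [h1.eq_zero] at h2
  exact neg_eq_zero.mp h2.eq_zero

theorem mem_domain_Hmax_iff (f : M.L2) : f ∈ M.Hmax.domain ↔ ∃ h, (f, h) ∈ M.maxGraph := by
  rw [← M.Hmax_graph, LinearPMap.mem_domain_iff]

variable [∀ v, Fintype (Inc G v)]

theorem blockDiag_eq_iff (hdeg : ∀ v, 1 ≤ deg G v) (enum : ∀ v, Fin (deg G v) ≃ Inc G v)
    (α : V → ℝ) (a b : ∀ v, Inc G v → ℂ) :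
    blockDiag enum (fun v => Cmat (deg G v) (α v)) a = blockDiag enum (fun v => Dmat (deg G v)) b ↔
      ∃ c : V → ℂ, (∀ v i, a v i = c v) ∧ ∀ v, ∑ i, b v i = (α v : ℂ) * c v := by
  rw [funext_iff]
  have h : ∀ v, blockDiag enum (fun v => Cmat (deg G v) (α v)) a v =
      blockDiag enum (fun v => Dmat (deg G v)) b v ↔
      ∃ c, (∀ i, a v i = c) ∧ ∑ i, b v i = (α v : ℂ) * c := fun v => by
    refine (Cmat_mulVec_eq_Dmat_mulVec_iff (hdeg v) (α v) (a v ∘ enum v) (b v ∘ enum v)).trans ?_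
    simp only [Function.comp_apply, (enum v).forall_congr_left, Equiv.apply_symm_apply,
      (enum v).sum_comp (b v)]
  simp only [h]
  constructor
  · intro h
    choose c hc using h
    exact ⟨c, fun v => (hc v).1, fun v => (hc v).2⟩
  · rintro ⟨c, h1, h2⟩ v
    exact ⟨c v, h1 v, h2 v⟩

/-- Moving `D⁰ Q̃` to the other side turns `C_α f = D g` into the delta condition with values `R̃⁻¹
f` and derivatives `R̃ g + Q̃ R̃⁻¹ f`. Continuity then reduces the values to a function `c` on the
vertices, which also eliminates the enumeration of the edges. -/
theorem mem_Theta0_iff (hdeg : ∀ v, 1 ≤ deg G v) (enum : ∀ v, Fin (deg G v) ≃ Inc G v)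
    (α : V → ℝ) (p : BdrySpace G × BdrySpace G) :
    p ∈ M.Theta0 enum α ↔ p.1 ∈ finiteVectors G ∧ p.2 ∈ finiteVectors G ∧ ∃ c : V → ℂ,
      (∀ v i, p.1 v i = ((√(M.len i.1) : ℝ) : ℂ) * c v) ∧
      ∀ v, ∑ i : Inc G v, (((√(M.len i.1) : ℝ) : ℂ) * p.2 v i +
        ((M.len i.1 : ℝ) : ℂ)⁻¹ * (-c v + c (opp i))) = (α v : ℂ) * c v := by
  have h1 : p ∈ M.Theta0 enum α ↔ (p.1 ∈ finiteVectors G ∧ p.2 ∈ finiteVectors G) ∧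
      M.Calpha enum α (coords G p.1) = M.Dmap enum (coords G p.2) := Iff.rfl
  rw [h1, and_assoc]
  refine and_congr_right fun _ => and_congr_right fun _ => ?_
  have h2 : M.Calpha enum α (coords G p.1) = M.Dmap enum (coords G p.2) ↔
      blockDiag enum (fun v => Cmat (deg G v) (α v)) (M.RinvMap (coords G p.1)) =
      blockDiag enum (fun v => Dmat (deg G v))
        (M.Rmap (coords G p.2) + M.Qmap (M.RinvMap (coords G p.1))) := by
    rw [map_add, ← sub_eq_iff_eq_add]
    rfl
  rw [h2, blockDiag_eq_iff hdeg]
  refine exists_congr fun c => ?_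
  have h3 : (∀ v i, M.RinvMap (coords G p.1) v i = c v) ↔
      ∀ v i, p.1 v i = ((√(M.len i.1) : ℝ) : ℂ) * c v :=
    forall_congr' fun v => forall_congr' fun i => by
      change ((√(M.len i.1) : ℝ) : ℂ)⁻¹ * p.1 v i = c v ↔ _
      rw [inv_mul_eq_iff_eq_mul₀ (M.sqrt_len_ne_zero _)]
  rw [h3]
  refine and_congr_right fun h4 => forall_congr' fun v => ?_
  refine Eq.congr_left (Finset.sum_congr rfl fun i _ => ?_)
  have h5 := h3.2 h4
  change _ + _ * (-M.RinvMap (coords G p.1) v i + M.RinvMap (coords G p.1) (opp i) (oppInc i)) = _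
  rw [h5, h5]
  rfl

/-! ### The pre-minimal operator in terms of the boundary maps -/

theorem mem_graph_Halpha0_iff (α : V → ℝ) (w : M.L2 × M.L2) :
    w ∈ (M.Halpha0 α).graph ↔ w ∈ M.maxGraph ∧ w.1 ∈ M.deltaDomain α := by
  rw [← M.Hmax_graph, LinearPMap.mem_graph_iff, LinearPMap.mem_graph_iff]
  constructor
  · rintro ⟨y, h1, h2⟩
    obtain ⟨h3, h4⟩ := Submodule.mem_inf.1 y.2
    rw [← h1, ← h2]
    exact ⟨⟨⟨y, h4⟩, rfl, rfl⟩, h3⟩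
  · rintro ⟨⟨y, h1, h2⟩, h3⟩
    rw [← h1] at h3
    exact ⟨⟨y, h3, y.2⟩, h1, h2⟩

variable {K : ℝ} (hK : ∀ e, M.len e ≤ K)

theorem bdryMap_mem_finiteVectors {w : M.L2 × M.L2} (h1 : {e | w.1 e ≠ 0}.Finite)
    (h2 : ∀ e, w.1 e = 0 → w.2 e = 0) :
    (bdryMap hK w).1 ∈ finiteVectors G ∧ (bdryMap hK w).2 ∈ finiteVectors G := by
  have h3 : {p : Σ v, Inc G v | w.1 p.2.1 ≠ 0}.Finite :=
    Set.Finite.subset ((h1.prod (finite_univ (α := Prop))).preimage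
      (M.incEmbedding_injective.injOn)) fun p hp => ⟨hp, mem_univ _⟩
  refine ⟨h3.subset fun p hp h0 => hp ?_, h3.subset fun p hp h0 => hp ?_⟩
  · have : (w.1 p.2.1, w.2 p.2.1) = 0 := Prod.ext h0 (h2 _ h0)
    rw [bdryMap_fst_apply, this, map_zero]
  · have : (w.1 p.2.1, w.2 p.2.1) = 0 := Prod.ext h0 (h2 _ h0)
    rw [bdryMap_snd_apply, this, map_zero]

/-- The second boundary map differs from the rescaled derivative exactly by the term that `Q̃`
restores, so the delta conditions become membership in `Θ_α⁰`. Finiteness of the boundary vectors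
follows from that of the set of nonzero edges. -/
theorem mem_graph_Halpha0_iff_bdryMap (hdeg : ∀ v, 1 ≤ deg G v)
    (enum : ∀ v, Fin (deg G v) ≃ Inc G v) (α : V → ℝ) (w : M.L2 × M.L2) :
    w ∈ (M.Halpha0 α).graph ↔
      w ∈ M.maxGraph ∧ {e | w.1 e ≠ 0}.Finite ∧ bdryMap hK w ∈ M.Theta0 enum α := by
  rw [mem_graph_Halpha0_iff]
  refine and_congr_right fun hw => ?_
  change _ ∧ _ ↔ _
  refine and_congr_right fun hfin => ?_
  have hd := M.hasVertexData_of_mem_maxGraph hw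
  have hfv := bdryMap_mem_finiteVectors hK hfin fun e => snd_apply_eq_zero hw
  rw [mem_Theta0_iff hdeg]
  simp only [hfv.1, hfv.2, true_and]
  have key : ∀ c : V → ℂ, (∀ v i, M.endValue w v i = c v) → ∀ v (i : Inc G v),
      ((√(M.len i.1) : ℝ) : ℂ) * (bdryMap hK w).2 v i +
        ((M.len i.1 : ℝ) : ℂ)⁻¹ * (-c v + c (opp i)) = M.endDeriv w v i := by
    intro c hc v i
    -- The second use of `hc` is at the opposite endpoint: continuity is needed there too.
    rw [endDeriv, hc, hc, bdryMap_snd_apply]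
    ring
  constructor
  · intro h
    choose c d hcd hsum using h
    have hc : ∀ v i, M.endValue w v i = c v := fun v i => ((hd v i).unique (hcd v i)).1
    refine ⟨c, fun v i => by rw [bdryMap_fst_eq_endValue, hc], fun v => ?_⟩
    rw [← hsum v]
    exact Finset.sum_congr rfl fun i _ => by
      rw [key c hc, ((hd v i).unique (hcd v i)).2]
  · rintro ⟨c, h1, h2⟩ v
    have hc : ∀ v i, M.endValue w v i = c v := fun v i => by
      have := h1 v i
      rw [bdryMap_fst_eq_endValue] at this
      exact mul_left_cancel₀ (M.sqrt_len_ne_zero _) this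
    refine ⟨c v, M.endDeriv w v, fun i => by rw [← hc v i]; exact hd v i, ?_⟩
    rw [← h2 v]
    exact Finset.sum_congr rfl fun i _ => (key c hc v i).symm

/-! ### The closure of the pre-minimal operator -/

open Classical in
-- Each boundary coordinate depends on a single edge, so cutting `w` down to one edge keeps the
-- boundary data zero and lands in `H_α⁰`. The sum of these pieces converges to `w` in the graph
-- norm.
theorem mem_closure_of_bdryMap_eq_zero (hdeg : ∀ v, 1 ≤ deg G v)
    (enum : ∀ v, Fin (deg G v) ≃ Inc G v) (α : V → ℝ) {w : M.L2 × M.L2} (hw : w ∈ M.maxGraph)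
    (h0 : bdryMap hK w = 0) : w ∈ (M.Halpha0 α).graph.topologicalClosure := by
  have hsum := (lp.hasSum_single (p := 2) (by simp) w.1).prodMk
    (lp.hasSum_single (p := 2) (by simp) w.2)
  refine mem_closure_of_tendsto hsum (Eventually.of_forall fun s => ?_)
  refine Submodule.sum_mem _ fun e _ => ?_
  rw [mem_graph_Halpha0_iff_bdryMap hK hdeg enum]
  have hcases : ∀ e', (e' = e ∧ (lp.single 2 e (w.1 e) : M.L2) e' = w.1 e' ∧
      (lp.single 2 e (w.2 e) : M.L2) e' = w.2 e') ∨ (e' ≠ e ∧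
      (lp.single 2 e (w.1 e) : M.L2) e' = 0 ∧ (lp.single 2 e (w.2 e) : M.L2) e' = 0) := by
    intro e'
    by_cases h : e' = e
    · subst h
      exact Or.inl ⟨rfl, lp.single_apply_self _ _ _, lp.single_apply_self _ _ _⟩
    · exact Or.inr ⟨h, lp.single_apply_ne _ _ _ h, lp.single_apply_ne _ _ _ h⟩
  refine ⟨fun e' => ?_, (finite_singleton e).subset fun e' he' => ?_, ?_⟩
  · change HasSecondDeriv ((lp.single 2 e (w.1 e) : M.L2) e') (-((lp.single 2 e (w.2 e) : M.L2) e'))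
    rcases hcases e' with ⟨-, h1, h2⟩ | ⟨-, h1, h2⟩
    · rw [h1, h2]; exact hw e'
    · rw [h1, h2, neg_zero]; exact ⟨0, HasWeakDeriv.zero, HasWeakDeriv.zero⟩
  · rcases hcases e' with ⟨h, -, -⟩ | ⟨-, h1, -⟩
    · exact h
    · exact absurd h1 he'
  · have : bdryMap hK (lp.single 2 e (w.1 e), lp.single 2 e (w.2 e)) = 0 := by
      have h0' := fun v (i : Inc G v) => congrArg (fun p => (p.1 v i, p.2 v i)) h0
      have hz : ∀ v (i : Inc G v), M.valueFunctional v i (w.1 i.1, w.2 i.1) = 0 ∧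
          M.derivFunctional v i (w.1 i.1, w.2 i.1) = 0 := fun v i =>
        ⟨congrArg Prod.fst (h0' v i), congrArg Prod.snd (h0' v i)⟩
      refine Prod.ext (bdry_ext fun v i => ?_) (bdry_ext fun v i => ?_)
      · rw [bdryMap_fst_apply]
        change M.valueFunctional v i ((lp.single 2 e (w.1 e) : M.L2) i.1,
          (lp.single 2 e (w.2 e) : M.L2) i.1) = 0
        rcases hcases i.1 with ⟨-, h1, h2⟩ | ⟨-, h1, h2⟩
        · rw [h1, h2]; exact (hz v i).1
        · rw [h1, h2]; exact map_zero _
      · rw [bdryMap_snd_apply]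
        change M.derivFunctional v i ((lp.single 2 e (w.1 e) : M.L2) i.1,
          (lp.single 2 e (w.2 e) : M.L2) i.1) = 0
        rcases hcases i.1 with ⟨-, h1, h2⟩ | ⟨-, h1, h2⟩
        · rw [h1, h2]; exact (hz v i).2
        · rw [h1, h2]; exact map_zero _
    rw [this]
    exact zero_mem _

/-- The lift is local: it vanishes on every edge whose four boundary coordinates vanish, so finite
vectors lift to functions on finitely many edges. -/
theorem liftMap_mem_graph_Halpha0 (hdeg : ∀ v, 1 ≤ deg G v)
    (enum : ∀ v, Fin (deg G v) ≃ Inc G v) (α : V → ℝ) {p : BdrySpace G × BdrySpace G}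
    (hp : p ∈ M.Theta0 enum α) : liftMap hK p ∈ (M.Halpha0 α).graph := by
  rw [mem_graph_Halpha0_iff_bdryMap hK hdeg enum]
  refine ⟨liftMap_mem_maxGraph hK p, ?_, by rwa [bdryMap_liftMap]⟩
  obtain ⟨h1, h2, -⟩ := (mem_Theta0_iff hdeg enum α p).1 hp
  refine ((Set.Finite.union h1 h2).image fun q : Σ v, Inc G v => q.2.1).subset fun e he => ?_
  by_contra hne
  simp only [mem_image, mem_union, not_exists, not_and] at hne
  have h3 : ∀ v (i : Inc G v), i.1 = e → p.1 v i = 0 ∧ p.2 v i = 0 := fun v i hi => by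
    have := mt (hne ⟨v, i⟩) (not_not.2 hi)
    simpa [not_or] using this
  have h4 : M.edgeData e p = 0 := by
    have hs := h3 _ (M.srcInc e) rfl
    have ht := h3 _ (M.tgtInc e) rfl
    ext j
    fin_cases j
    exacts [hs.1, ht.1, hs.2, ht.2]
  exact he ((congrArg (edgeLift (M.len e)) h4).trans (map_zero _))

/-- One inclusion is closedness of the graph of `H_max` and continuity of `bdryMap`. The other
splits off the lift of the boundary data, leaving a remainder in the kernel of `bdryMap`. -/
theorem mem_closure_graph_Halpha0_iff (hdeg : ∀ v, 1 ≤ deg G v)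
    (enum : ∀ v, Fin (deg G v) ≃ Inc G v) (α : V → ℝ) (w : M.L2 × M.L2) :
    w ∈ (M.Halpha0 α).graph.topologicalClosure ↔
      w ∈ M.maxGraph ∧ bdryMap hK w ∈ M.Theta enum α := by
  constructor
  · intro hw
    have h1 : IsClosed ((M.maxGraph : Set (M.L2 × M.L2)) ∩
        bdryMap hK ⁻¹' (M.Theta enum α : Set (BdrySpace G × BdrySpace G))) :=
      M.isClosed_maxGraph.inter
        ((Submodule.isClosed_topologicalClosure _).preimage (bdryMap hK).continuous)
    refine closure_minimal (fun w' hw' => ?_) h1 hw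
    obtain ⟨h2, -, h3⟩ := (mem_graph_Halpha0_iff_bdryMap hK hdeg enum α w').1 hw'
    exact ⟨h2, Submodule.le_topologicalClosure _ h3⟩
  · rintro ⟨hw, hΘ⟩
    have h1 : liftMap hK (bdryMap hK w) ∈ (M.Halpha0 α).graph.topologicalClosure :=
      map_mem_closure (liftMap hK).continuous hΘ
        fun p hp => liftMap_mem_graph_Halpha0 hK hdeg enum α hp
    have h2 : w - liftMap hK (bdryMap hK w) ∈ (M.Halpha0 α).graph.topologicalClosure :=
      mem_closure_of_bdryMap_eq_zero hK hdeg enum α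
        (sub_mem hw (liftMap_mem_maxGraph hK _)) (by rw [map_sub, bdryMap_liftMap, sub_self])
    simpa using add_mem h2 h1

/-! ### Closability and the domain of `H_α`. -/

theorem _root_.LinearPMap.isClosable_of_single_valued {E F : Type*} [NormedAddCommGroup E]
    [NormedSpace ℂ E] [NormedAddCommGroup F] [NormedSpace ℂ F] (T : E →ₗ.[ℂ] F)
    (h : ∀ p ∈ T.graph.topologicalClosure, p.1 = 0 → p.2 = 0) : T.IsClosable :=
  ⟨_, (Submodule.toLinearPMap_graph_eq _ h).symm⟩

theorem isClosable_Halpha0 (α : V → ℝ) : (M.Halpha0 α).IsClosable := by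
  refine LinearPMap.isClosable_of_single_valued _ fun p hp => M.maxGraph_single_valued p ?_
  exact closure_minimal (fun w hw => ((mem_graph_Halpha0_iff α w).1 hw).1) M.isClosed_maxGraph hp

theorem mem_domain_Halpha_iff (hK : ∀ e, M.len e ≤ K) (hdeg : ∀ v, 1 ≤ deg G v)
    (enum : ∀ v, Fin (deg G v) ≃ Inc G v) (α : V → ℝ) (f : M.L2) :
    f ∈ (M.Halpha α).domain ↔
      f ∈ M.Hmax.domain ∧ ∃ x y, M.IsBoundaryData f x y ∧ (x, y) ∈ M.Theta enum α := by
  rw [LinearPMap.mem_domain_iff, Halpha,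
    ← (isClosable_Halpha0 α).graph_closure_eq_closure_graph, mem_domain_Hmax_iff]
  simp only [mem_closure_graph_Halpha0_iff hK hdeg enum]
  constructor
  · rintro ⟨h, h1, h2⟩
    exact ⟨⟨h, h1⟩, _, _, (isBoundaryData_iff hK h1 _ _).2 rfl, h2⟩
  · rintro ⟨⟨h, h1⟩, x, y, h2, h3⟩
    refine ⟨h, h1, ?_⟩
    rwa [(isBoundaryData_iff hK h1 x y).1 h2] at h3

theorem existsUnique_isBoundaryData (hK : ∀ e, M.len e ≤ K) {f : M.L2} (hf : f ∈ M.Hmax.domain) :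
    ∃! p : BdrySpace G × BdrySpace G, M.IsBoundaryData f p.1 p.2 := by
  obtain ⟨h, h1⟩ := (mem_domain_Hmax_iff f).1 hf
  exact ⟨bdryMap hK (f, h), (isBoundaryData_iff hK h1 _ _).2 rfl,
    fun p hp => (isBoundaryData_iff hK h1 p.1 p.2).1 hp⟩

end MetricGraph

/-! ### Linear relations compressed to an operator -/

section Compression

variable {K B : Type*} [NormedAddCommGroup K] [InnerProductSpace ℂ K] [CompleteSpace K]
  [NormedAddCommGroup B] [InnerProductSpace ℂ B] [CompleteSpace B]

open ContinuousLinearMap in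
theorem adjoint_isometry_apply (U : K →ₗᵢ[ℂ] B) (f : K) :
    adjoint U.toContinuousLinearMap (U f) = f := by
  refine ext_inner_left ℂ fun g => ?_
  rw [adjoint_inner_right]
  exact U.inner_map_map g f

open ContinuousLinearMap in
-- Since `U* U = 1`, the conditions `U U* x = x` and `(U* x, U* y) ∈ closure T` are closed, which
-- gives one inclusion. Conversely `y = U U* y + (y - U U* y)`, where the last term lies in `ker U*`
-- and so is covered by `h3`.
theorem mem_closure_relation_iff (U : K →ₗᵢ[ℂ] B) (T : K →ₗ.[ℂ] K) (hT : T.IsClosable)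
    (Θ : Submodule ℂ (B × B))
    (h1 : ∀ p ∈ Θ, ∃ f, p.1 = U f ∧ (f, adjoint U.toContinuousLinearMap p.2) ∈ T.graph)
    (h2 : ∀ q ∈ T.graph, (U q.1, U q.2) ∈ Θ)
    (h3 : ∀ y, adjoint U.toContinuousLinearMap y = 0 → (0, y) ∈ Θ.topologicalClosure)
    (p : B × B) : p ∈ Θ.topologicalClosure ↔
      ∃ f, p.1 = U f ∧ (f, adjoint U.toContinuousLinearMap p.2) ∈ T.closure.graph := by
  rw [← hT.graph_closure_eq_closure_graph]
  set A := adjoint U.toContinuousLinearMap with hA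
  constructor
  · intro hp
    have hc : IsClosed ({p : B × B | U (A p.1) = p.1} ∩
        (fun p : B × B => (A p.1, A p.2)) ⁻¹' (T.graph.topologicalClosure : Set (K × K))) :=
      (isClosed_eq (by fun_prop) (by fun_prop)).inter
        ((Submodule.isClosed_topologicalClosure _).preimage (by fun_prop))
    have hmem := closure_minimal (fun p hp => ?_) hc hp
    · exact ⟨A p.1, hmem.1.symm, hmem.2⟩
    · obtain ⟨f, hf, hg⟩ := h1 p hp
      have : A p.1 = f := by rw [hf, hA, adjoint_isometry_apply]
      refine ⟨by rw [mem_ofPred_eq, this, hf], ?_⟩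
      rw [mem_preimage, this]
      exact Submodule.le_topologicalClosure _ hg
  · rintro ⟨f, hf, hg⟩
    have e1 : (U f, U (A p.2)) ∈ Θ.topologicalClosure :=
      map_mem_closure (f := fun q : K × K => (U q.1, U q.2)) (by fun_prop) hg h2
    have e2 := h3 (p.2 - U (A p.2)) (by rw [map_sub, adjoint_isometry_apply, sub_self])
    have := add_mem e1 e2
    simpa [← hf] using this

open ContinuousLinearMap in
-- The multivalued part of the closure is `ker U*`, whose orthogonal complement is the closed range
-- of `U`. Density of the domain of `T` makes this range the closure of the domain of the relation.
theorem exists_equiv_operatorPart (U : K →ₗᵢ[ℂ] B) (T : K →ₗ.[ℂ] K) (hT : T.IsClosable)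
    (hd : Dense (T.domain : Set K)) (Θ : Submodule ℂ (B × B))
    (h1 : ∀ p ∈ Θ, ∃ f, p.1 = U f ∧ (f, adjoint U.toContinuousLinearMap p.2) ∈ T.graph)
    (h2 : ∀ q ∈ T.graph, (U q.1, U q.2) ∈ Θ)
    (h3 : ∀ y, adjoint U.toContinuousLinearMap y = 0 → (0, y) ∈ Θ.topologicalClosure) :
    ∃ W : K ≃ₗᵢ[ℂ] (relDomain Θ.topologicalClosure).topologicalClosure,
      ∀ p : B × B, p ∈ operatorPart Θ.topologicalClosure ↔
        ∃ q ∈ T.closure.graph, ((W q.1).1, (W q.2).1) = p := by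
  have key := mem_closure_relation_iff U T hT Θ h1 h2 h3
  have hrange : LinearMap.range U.toLinearMap =
      (relDomain Θ.topologicalClosure).topologicalClosure := by
    apply le_antisymm
    · rintro _ ⟨f, rfl⟩
      refine map_mem_closure U.continuous (hd f) fun g hg => ?_
      obtain ⟨g', hg'⟩ := T.mem_domain_iff.1 hg
      exact ⟨_, Submodule.le_topologicalClosure _ (h2 _ hg'), rfl⟩
    · refine Submodule.topologicalClosure_minimal _ ?_ U.isometry.isClosedEmbedding.isClosed_range
      rintro _ ⟨p, hp, rfl⟩
      obtain ⟨f, hf, -⟩ := (key p).1 hp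
      exact ⟨f, hf.symm⟩
  refine ⟨U.equivRange.trans (LinearIsometryEquiv.ofEq _ _ hrange), fun p => ?_⟩
  change _ ↔ ∃ q ∈ T.closure.graph, (U q.1, U q.2) = p
  set A := adjoint U.toContinuousLinearMap with hA
  constructor
  · rintro ⟨hp, hort⟩
    obtain ⟨f, hf, hg⟩ := (key p).1 hp
    refine ⟨_, hg, Prod.ext hf.symm ?_⟩
    -- The component of `p.2` off the range of `U` belongs to the multivalued part, so it is
    -- orthogonal to `p.2` and, by the adjoint relation, to the range of `U`; hence it is zero.
    have h4 : A (p.2 - U (A p.2)) = 0 := by rw [map_sub, adjoint_isometry_apply, sub_self]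
    have h5 := hort _ (h3 _ h4)
    have h6 : inner ℂ (p.2 - U (A p.2)) (U (A p.2)) = 0 := by
      have := adjoint_inner_left U.toContinuousLinearMap (A p.2) (p.2 - U (A p.2))
      rw [← hA, h4, inner_zero_left] at this
      exact this.symm
    have h7 : inner ℂ (p.2 - U (A p.2)) (p.2 - U (A p.2)) = 0 := by
      rw [inner_sub_right, h5, h6, sub_zero]
    exact (sub_eq_zero.1 (inner_self_eq_zero.1 h7)).symm
  · rintro ⟨q, hq, rfl⟩
    refine ⟨(key _).2 ⟨q.1, rfl, by rw [adjoint_isometry_apply]; exact hq⟩, fun g hg => ?_⟩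
    obtain ⟨f, hf, hg'⟩ := (key _).1 hg
    have hf0 : f = 0 := U.injective (by rw [map_zero]; exact hf.symm)
    have hg0 : A g = 0 := LinearPMap.graph_fst_eq_zero_snd _ hg' hf0
    have := adjoint_inner_left U.toContinuousLinearMap q.2 g
    rw [← hA, hg0, inner_zero_left] at this
    exact this.symm

end Compression

namespace MetricGraph

variable {V : Type*} {G : SimpleGraph V} {M : MetricGraph G}

/-! ### The discrete Laplacian -/

theorem adj_opp {v : V} (i : Inc G v) : G.Adj v (opp i) := by
  rw [← G.mem_edgeSet, show s(v, opp i) = (i.1 : Sym2 V) from Sym2.other_spec i.2]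
  exact i.1.2

theorem edgeWeight_opp {v : V} (i : Inc G v) : M.edgeWeight v (opp i) = (M.len i.1)⁻¹ := by
  rw [edgeWeight, dif_pos (adj_opp i)]
  congr 2
  exact Subtype.ext (Sym2.other_spec i.2)

theorem opp_injective (v : V) : Function.Injective (opp : Inc G v → V) := by
  intro i j h
  refine Subtype.ext (Subtype.ext ?_)
  rw [← show s(v, opp i) = (i.1 : Sym2 V) from Sym2.other_spec i.2,
    ← show s(v, opp j) = (j.1 : Sym2 V) from Sym2.other_spec j.2, h]

variable [∀ v, Fintype (Inc G v)]

/-- In a simple graph an incident edge is determined by its other endpoint, so a sum over neighbours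
is a sum over incident edges. -/
theorem finsum_edgeWeight_mul (v : V) (g : V → ℂ) :
    ∑ᶠ u, (M.edgeWeight v u : ℂ) * g u =
      ∑ i : Inc G v, ((M.len i.1 : ℝ) : ℂ)⁻¹ * g (opp i) := by
  classical
  rw [finsum_eq_sum_of_support_subset (s := Finset.univ.image (opp : Inc G v → V)),
    Finset.sum_image fun i _ j _ h => opp_injective v h]
  · exact Finset.sum_congr rfl fun i _ => by rw [edgeWeight_opp, Complex.ofReal_inv]
  · intro u hu
    by_cases h : G.Adj v u
    · rw [Finset.coe_image, Finset.coe_univ, image_univ]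
      let i : Inc G v := ⟨⟨s(v, u), h⟩, Sym2.mem_mk_left v u⟩
      refine ⟨i, ?_⟩
      exact Sym2.congr_right.1 (Sym2.other_spec i.2)
    · exact absurd (by simp [M.edgeWeight_of_not_adj h]) hu

theorem tau_eq_sum (α : V → ℝ) (f : V → ℂ) (v : V) : M.tau α f v =
    ((√(M.weight v) : ℝ) : ℂ)⁻¹ * ((∑ i : Inc G v, ((M.len i.1 : ℝ) : ℂ)⁻¹ *
      (f v / ((√(M.weight v) : ℝ) : ℂ) - f (opp i) / ((√(M.weight (opp i)) : ℝ) : ℂ))) +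
      (α v : ℂ) / ((√(M.weight v) : ℝ) : ℂ) * f v) := by
  rw [tau, M.finsum_edgeWeight_mul v
    fun u => f v / ((√(M.weight v) : ℝ) : ℂ) - f u / ((√(M.weight u) : ℝ) : ℂ)]

theorem mem_graph_discreteLaplacian0_iff (α : V → ℝ)
    (q : lp (fun _ : V => ℂ) 2 × lp (fun _ : V => ℂ) 2) :
    q ∈ (M.discreteLaplacian0 α).graph ↔ {v | q.1 v ≠ 0}.Finite ∧ ∀ v, q.2 v = M.tau α q.1 v := by
  rw [LinearPMap.mem_graph_iff]
  constructor
  · rintro ⟨y, h1, h2⟩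
    rw [← h1, ← h2]
    exact ⟨y.2, fun v => rfl⟩
  · rintro ⟨h1, h2⟩
    exact ⟨⟨q.1, h1⟩, rfl, lp.ext (funext fun v => (h2 v).symm)⟩

/-- Local finiteness makes `τ` at each vertex a finite combination of coordinates. The relation `q.2
= τ q.1` is therefore closed, and it forces `q.2 = 0` when `q.1 = 0`. -/
theorem isClosable_discreteLaplacian0 (α : V → ℝ) : (M.discreteLaplacian0 α).IsClosable := by
  refine LinearPMap.isClosable_of_single_valued _ fun p hp h0 => ?_
  have hcont : ∀ u : V, Continuous fun f : lp (fun _ : V => ℂ) 2 => f u := continuous_lp_apply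
  have hc : IsClosed {q : lp (fun _ : V => ℂ) 2 × lp (fun _ : V => ℂ) 2 |
      ∀ v, q.2 v = M.tau α q.1 v} := by
    simp only [ofPred_forall, tau_eq_sum]
    refine isClosed_iInter fun v => isClosed_eq ((hcont v).comp continuous_snd) ?_
    have hcont' : ∀ u : V, Continuous fun q : lp (fun _ : V => ℂ) 2 × lp (fun _ : V => ℂ) 2 =>
      q.1 u := fun u => (hcont u).comp continuous_fst
    fun_prop
  have h1 := closure_minimal
    (fun q hq => ((mem_graph_discreteLaplacian0_iff α q).1 hq).2) hc hp
  refine lp.ext (funext fun v => ?_)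
  rw [h1 v, h0, tau_eq_sum]
  simp

theorem dense_domain_discreteLaplacian0 (α : V → ℝ) :
    Dense ((M.discreteLaplacian0 α).domain : Set (lp (fun _ : V => ℂ) 2)) := by
  classical
  intro f
  refine mem_closure_of_tendsto (lp.hasSum_single (p := 2) (by simp) f)
    (Eventually.of_forall fun s => Submodule.sum_mem _ fun v _ => ?_)
  refine (finite_singleton v).subset fun u hu => ?_
  by_contra h
  exact hu (lp.single_apply_ne _ _ _ h)

/-! ### The unitary equivalence -/

theorem weight_pos (hdeg : ∀ v, 1 ≤ deg G v) (v : V) : 0 < M.weight v := by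
  have : Nonempty (Inc G v) := Fintype.card_pos_iff.1 (hdeg v)
  exact Finset.sum_pos (fun i _ => M.len_pos i.1) Finset.univ_nonempty

variable (M) in
/-- The vector with coordinates `|e|^{1/2} m(v)^{-1/2}`, `e` incident to `v`. -/
def unitVector (v : V) : EuclideanSpace ℂ (Inc G v) :=
  WithLp.toLp 2 fun i => ((√(M.len i.1) : ℝ) : ℂ) * ((√(M.weight v) : ℝ) : ℂ)⁻¹

theorem unitVector_apply (v : V) (i : Inc G v) :
    M.unitVector v i = ((√(M.len i.1) : ℝ) : ℂ) * ((√(M.weight v) : ℝ) : ℂ)⁻¹ := rfl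

theorem norm_unitVector (hdeg : ∀ v, 1 ≤ deg G v) (v : V) : ‖M.unitVector v‖ = 1 := by
  have h := weight_pos (M := M) hdeg v
  rw [← sq_eq_sq₀ (norm_nonneg _) zero_le_one, EuclideanSpace.norm_sq_eq]
  have : ∀ i : Inc G v, ‖M.unitVector v i‖ ^ 2 = M.len i.1 * (M.weight v)⁻¹ := fun i => by
    rw [unitVector_apply, norm_mul, norm_inv, Complex.norm_real, Complex.norm_real, mul_pow,
      inv_pow, Real.norm_eq_abs, Real.norm_eq_abs, sq_abs, sq_abs, Real.sq_sqrt h.le,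
      Real.sq_sqrt (M.len_pos _).le]
  simp only [this]
  rw [← Finset.sum_mul, one_pow]
  exact mul_inv_cancel₀ h.ne'

theorem norm_smul_unitVector (hdeg : ∀ v, 1 ≤ deg G v) (v : V) (z : ℂ) :
    ‖z • M.unitVector v‖ = ‖z‖ := by
  rw [norm_smul, norm_unitVector hdeg, mul_one]

/-- The isometry `f ↦ (f(v) ω_v)_v`, with the unit vectors `ω_v`. -/
def vertexIsometry (hdeg : ∀ v, 1 ≤ deg G v) : lp (fun _ : V => ℂ) 2 →ₗᵢ[ℂ] BdrySpace G where
  toFun f := ⟨fun v => f v • M.unitVector v, memℓp_two_iff.2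
    ((summable_norm_sq f).congr fun v => by rw [norm_smul_unitVector hdeg])⟩
  map_add' f g := lp.ext (funext fun v => add_smul (f v) (g v) _)
  map_smul' c f := lp.ext (funext fun v => mul_smul c (f v) _)
  norm_map' f := by
    rw [lp.norm_eq_tsum_rpow (by simp), lp.norm_eq_tsum_rpow (by simp)]
    congr 1
    exact tsum_congr fun v => congrArg (· ^ _) (norm_smul_unitVector hdeg v (f v))

theorem vertexIsometry_apply (hdeg : ∀ v, 1 ≤ deg G v) (f : lp (fun _ : V => ℂ) 2) (v : V)
    (i : Inc G v) : vertexIsometry (M := M) hdeg f v i =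
      f v * (((√(M.len i.1) : ℝ) : ℂ) * ((√(M.weight v) : ℝ) : ℂ)⁻¹) := rfl

open ContinuousLinearMap in
theorem adjoint_vertexIsometry_apply (hdeg : ∀ v, 1 ≤ deg G v) (y : BdrySpace G) (v : V) :
    adjoint (vertexIsometry (M := M) hdeg).toContinuousLinearMap y v =
      ((√(M.weight v) : ℝ) : ℂ)⁻¹ * ∑ i : Inc G v, ((√(M.len i.1) : ℝ) : ℂ) * y v i := by
  classical
  -- Pairing with the basis vector at `v` extracts one coordinate of the adjoint.
  have h1 : vertexIsometry (M := M) hdeg (lp.single 2 v 1) = lp.single 2 v (M.unitVector v) := by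
    refine lp.ext (funext fun u => ?_)
    change (lp.single 2 v (1 : ℂ) : lp (fun _ : V => ℂ) 2) u • M.unitVector u = _
    by_cases h : u = v
    · subst h
      rw [lp.single_apply_self, lp.single_apply_self, one_smul]
    · rw [lp.single_apply_ne _ _ _ h, lp.single_apply_ne _ _ _ h, zero_smul]
  have h2 := adjoint_inner_right (vertexIsometry (M := M) hdeg).toContinuousLinearMap
    (lp.single 2 v (1 : ℂ)) y
  rw [lp.inner_single_left] at h2
  have h3 : inner ℂ ((vertexIsometry (M := M) hdeg).toContinuousLinearMap (lp.single 2 v (1 : ℂ))) y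
      = inner ℂ (M.unitVector v) (y v) :=
    (congrArg (inner ℂ · y) h1).trans (lp.inner_single_left v (M.unitVector v) y)
  rw [h3] at h2
  rw [show inner ℂ (1 : ℂ) (adjoint (vertexIsometry (M := M) hdeg).toContinuousLinearMap y v) =
    adjoint (vertexIsometry (M := M) hdeg).toContinuousLinearMap y v by simp] at h2
  rw [h2, PiLp.inner_apply, Finset.mul_sum]
  refine Finset.sum_congr rfl fun i _ => ?_
  rw [unitVector_apply]
  simp only [RCLike.inner_apply, map_mul, map_inv₀, Complex.conj_ofReal]
  ring

theorem sqrt_weight_ne_zero (hdeg : ∀ v, 1 ≤ deg G v) (v : V) :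
    ((√(M.weight v) : ℝ) : ℂ) ≠ 0 :=
  Complex.ofReal_ne_zero.2 (Real.sqrt_pos.2 (weight_pos hdeg v)).ne'

theorem sum_len_eq (v : V) (hdeg : ∀ v, 1 ≤ deg G v) : ∑ i : Inc G v, ((M.len i.1 : ℝ) : ℂ) =
    ((√(M.weight v) : ℝ) : ℂ) * ((√(M.weight v) : ℝ) : ℂ) := by
  rw [← Complex.ofReal_mul, Real.mul_self_sqrt (weight_pos hdeg v).le, weight, Complex.ofReal_sum]

theorem mem_finiteVectors_of_finite {x : BdrySpace G} (h : {v | x v ≠ 0}.Finite) :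
    x ∈ finiteVectors G := by
  have h1 : (⋃ v ∈ {v | x v ≠ 0}, (fun i => (⟨v, i⟩ : Σ v, Inc G v)) '' univ).Finite :=
    h.biUnion fun v _ => finite_univ.image _
  refine h1.subset fun p hp => ?_
  simp only [mem_iUnion]
  exact ⟨p.1, fun h0 => hp (by rw [h0]; rfl), p.2, mem_univ _, rfl⟩

open ContinuousLinearMap in
theorem exists_mem_graph_of_mem_Theta0 (hdeg : ∀ v, 1 ≤ deg G v)
    (enum : ∀ v, Fin (deg G v) ≃ Inc G v) (α : V → ℝ) {p : BdrySpace G × BdrySpace G}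
    (hp : p ∈ M.Theta0 enum α) : ∃ f, p.1 = vertexIsometry (M := M) hdeg f ∧
      (f, adjoint (vertexIsometry (M := M) hdeg).toContinuousLinearMap p.2) ∈
        (M.discreteLaplacian0 α).graph := by
  obtain ⟨h1, -, c, h3, h4⟩ := (mem_Theta0_iff hdeg enum α p).1 hp
  have hm := sqrt_weight_ne_zero (M := M) hdeg
  have hfin : {v | ((√(M.weight v) : ℝ) : ℂ) * c v ≠ 0}.Finite := by
    refine (Set.Finite.image Sigma.fst h1).subset fun v hv => ?_
    obtain ⟨i⟩ : Nonempty (Inc G v) := Fintype.card_pos_iff.1 (hdeg v)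
    refine ⟨⟨v, i⟩, ?_, rfl⟩
    change p.1 v i ≠ 0
    rw [h3]
    exact mul_ne_zero (M.sqrt_len_ne_zero _) (right_ne_zero_of_mul hv)
  -- The factor `√m(v)` cancels the normalisation of `ω_v`, so that `U f` has coordinates `|e|^{1/2}
  -- c(v)`.
  let f : lp (fun _ : V => ℂ) 2 :=
    ⟨fun v => ((√(M.weight v) : ℝ) : ℂ) * c v, (memℓp_zero hfin).of_exponent_ge zero_le⟩
  have hf : ∀ v, f v = ((√(M.weight v) : ℝ) : ℂ) * c v := fun v => rfl
  refine ⟨f, bdry_ext fun v i => ?_, (mem_graph_discreteLaplacian0_iff α _).2 ⟨hfin, fun v => ?_⟩⟩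
  · have := hm v
    rw [h3, vertexIsometry_apply, hf]
    field_simp
  · rw [adjoint_vertexIsometry_apply, tau_eq_sum]
    congr 1
    simp only [hf, mul_div_cancel_left₀ _ (hm _)]
    rw [← mul_assoc, div_mul_cancel₀ _ (hm v), ← h4 v, ← Finset.sum_add_distrib]
    exact Finset.sum_congr rfl fun i _ => by ring

theorem vertexIsometry_mem_Theta0 (hdeg : ∀ v, 1 ≤ deg G v)
    (enum : ∀ v, Fin (deg G v) ≃ Inc G v) (α : V → ℝ)
    {q : lp (fun _ : V => ℂ) 2 × lp (fun _ : V => ℂ) 2}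
    (hq : q ∈ (M.discreteLaplacian0 α).graph) :
    (vertexIsometry (M := M) hdeg q.1, vertexIsometry (M := M) hdeg q.2) ∈ M.Theta0 enum α := by
  obtain ⟨h1, h2⟩ := (mem_graph_discreteLaplacian0_iff α q).1 hq
  have hm := sqrt_weight_ne_zero (M := M) hdeg
  have hfin : ∀ f : lp (fun _ : V => ℂ) 2, {v | f v ≠ 0}.Finite →
      vertexIsometry (M := M) hdeg f ∈ finiteVectors G := fun f hf =>
    mem_finiteVectors_of_finite (hf.subset fun v hv h0 => hv (by
      change f v • M.unitVector v = 0
      rw [h0, zero_smul]))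
  have h3 : {v | q.2 v ≠ 0}.Finite := by
    simp only [h2]
    exact M.tau_finite_support α h1
  refine (mem_Theta0_iff hdeg enum α _).2 ⟨hfin _ h1, hfin _ h3,
    fun v => q.1 v / ((√(M.weight v) : ℝ) : ℂ), fun v i => ?_, fun v => ?_⟩
  · rw [vertexIsometry_apply]; ring
  · simp only [vertexIsometry_apply]
    rw [Finset.sum_add_distrib]
    -- The weights `|e|` sum to `m(v)`, so the first sum becomes `√m(v) (τ f)(v)`; its edge
    -- differences cancel against the `Q̃` terms and only the `α(v)` term remains.
    have e1 : ∀ i : Inc G v, ((√(M.len i.1) : ℝ) : ℂ) *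
        (q.2 v * (((√(M.len i.1) : ℝ) : ℂ) * ((√(M.weight v) : ℝ) : ℂ)⁻¹)) =
        q.2 v * ((√(M.weight v) : ℝ) : ℂ)⁻¹ * ((M.len i.1 : ℝ) : ℂ) := fun i => by
      rw [← M.sqrt_len_mul_self]; ring
    simp only [e1]
    rw [← Finset.mul_sum, sum_len_eq v hdeg, mul_assoc, inv_mul_cancel_left₀ (hm v), h2,
      tau_eq_sum, mul_comm, mul_inv_cancel_left₀ (hm v), add_right_comm, ← Finset.sum_add_distrib,
      Finset.sum_eq_zero fun i _ => by ring, zero_add]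
    ring

open ContinuousLinearMap in
-- With zero first component, membership in `Θ_α⁰` reduces to finiteness and `∑ |e|^{1/2} y_{v,e} =
-- 0` at each vertex. This condition decouples over the vertices, so truncations of `y` to finitely
-- many vertices lie in `Θ_α⁰`.
theorem zero_prod_mem_Theta (hdeg : ∀ v, 1 ≤ deg G v)
    (enum : ∀ v, Fin (deg G v) ≃ Inc G v) (α : V → ℝ) {y : BdrySpace G}
    (hy : adjoint (vertexIsometry (M := M) hdeg).toContinuousLinearMap y = 0) :
    (0, y) ∈ (M.Theta0 enum α).topologicalClosure := by
  classical
  have hy' : ∀ v, ∑ i : Inc G v, ((√(M.len i.1) : ℝ) : ℂ) * y v i = 0 := fun v => by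
    have := adjoint_vertexIsometry_apply (M := M) hdeg y v
    rw [hy] at this
    exact (mul_eq_zero.1 this.symm).resolve_left (inv_ne_zero (sqrt_weight_ne_zero hdeg v))
  have hsum := (hasSum_zero : HasSum (fun _ : V => (0 : BdrySpace G)) 0).prodMk
    (lp.hasSum_single (p := 2) (by simp) y)
  refine mem_closure_of_tendsto hsum (Eventually.of_forall fun s => ?_)
  refine Submodule.sum_mem _ fun v _ => ?_
  refine (mem_Theta0_iff hdeg enum α _).2 ⟨zero_mem _, mem_finiteVectors_of_finite
    ((finite_singleton v).subset fun u hu => ?_), 0, fun u i => by simp, fun u => ?_⟩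
  · by_contra h
    exact hu (lp.single_apply_ne _ _ _ h)
  · by_cases h : u = v
    · subst h
      simpa [lp.single_apply_self] using hy' u
    · simp [Pi.single_eq_of_ne h]

theorem exists_unitaryEquiv (hdeg : ∀ v, 1 ≤ deg G v)
    (enum : ∀ v, Fin (deg G v) ≃ Inc G v) (α : V → ℝ) :
    ∃ U : lp (fun _ : V => ℂ) 2 ≃ₗᵢ[ℂ] (relDomain (M.Theta enum α)).topologicalClosure,
      ∀ p : BdrySpace G × BdrySpace G, p ∈ operatorPart (M.Theta enum α) ↔
        ∃ q ∈ (M.discreteLaplacian α).graph, ((U q.1).1, (U q.2).1) = p :=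
  exists_equiv_operatorPart (vertexIsometry (M := M) hdeg) _ (isClosable_discreteLaplacian0 α)
    (dense_domain_discreteLaplacian0 α) _
    (fun _ hp => exists_mem_graph_of_mem_Theta0 hdeg enum α hp)
    (fun _ hq => vertexIsometry_mem_Theta0 hdeg enum α hq)
    (fun _ hy => zero_prod_mem_Theta hdeg enum α hy)

end MetricGraph

end QuantumGraph

end

open QuantumGraph in
theorem proposition3p4 {V : Type*} [Countable V] (G : SimpleGraph V) (hconn : G.Connected)
    (M : MetricGraph G) [∀ v, Fintype (Inc G v)] (hdeg : ∀ v, 1 ≤ deg G v)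
    (hlen : BddAbove (Set.range M.len)) (α : V → ℝ)
    (enum : ∀ v, Fin (deg G v) ≃ Inc G v) :
    -- the boundary maps are defined on the whole domain of the maximal operator
    (∀ f ∈ M.Hmax.domain, ∃! p : MetricGraph.BdrySpace G × MetricGraph.BdrySpace G,
      M.IsBoundaryData f p.1 p.2) ∧
    -- both pre-minimal operators are closable, so that their closures are operators
    (M.Halpha0 α).IsClosable ∧ (M.discreteLaplacian0 α).IsClosable ∧
    -- the domain of the operator with delta couplings
    (∀ f : M.L2, f ∈ (M.Halpha α).domain ↔
      f ∈ M.Hmax.domain ∧ ∃ x y, M.IsBoundaryData f x y ∧ (x, y) ∈ M.Theta enum α) ∧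
    -- unitary equivalence of the operator part with the discrete Laplacian
    ∃ U : lp (fun _ : V => ℂ) 2 ≃ₗᵢ[ℂ] (relDomain (M.Theta enum α)).topologicalClosure,
      ∀ p : MetricGraph.BdrySpace G × MetricGraph.BdrySpace G,
        p ∈ operatorPart (M.Theta enum α) ↔
          ∃ q ∈ (M.discreteLaplacian α).graph, ((U q.1).1, (U q.2).1) = p := by
  obtain ⟨K, hK⟩ := hlen
  have hK' : ∀ e, M.len e ≤ K := fun e => hK ⟨e, rfl⟩
  exact ⟨fun _ hf => MetricGraph.existsUnique_isBoundaryData hK' hf,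
    MetricGraph.isClosable_Halpha0 α, MetricGraph.isClosable_discreteLaplacian0 α,
    MetricGraph.mem_domain_Halpha_iff hK' hdeg enum α,
    MetricGraph.exists_unitaryEquiv hdeg enum α⟩
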